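/- **Setting.** All densities, distances and powers are in consistent units. Base stations (BSs) form a homogeneous Poisson point process $\Phi$ of density $\lambda>0$ in the plane; active users (UEs) have density $\rho\in(0,\infty)$; a typical UE is at the origin. BSs without users are idle: as in the standard model of the idle mode, the active BSs form a homogeneous Poisson process $\tilde\Phi\subset\Phi$, obtained from $\Phi$ by independent thinning, of density $$\tilde\lambda=\lambda\Bigl[1-\bigl(1+\tfrac{\rho}{q\lambda}\bigr)^{-q}\Bigr],\qquad q>0 .$$ The antenna height difference is $L$, so that a link of horizontal length $r$ has 3D length $w=\sqrt{r^2+L^2}$. There are $N\ge 1$ path loss pieces with break points $L<d_1<\dots<d_{N-1}$; piece $1$ is $L\le w\le d_1$, piece $n$ is $d_{n-1}<w\le d_n$, piece $N$ is $w>d_{N-1}$. On piece $n$ a link is line-of-sight (LoS) with probability $\mathrm{Pr}^{\rm L}_n(w)\in[0,1]$, non-increasing in $w$ on that piece, with path loss $\zeta^{\rm L}_n(w)=A^{\rm L}_nw^{-\alpha^{\rm L}_n}$, and otherwise non-line-of-sight (NLoS) with path loss $\zeta^{\rm NL}_n(w)=A^{\rm NL}_nw^{-\alpha^{\rm NL}_n}$,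 where all $A_n,\alpha_n>0$. Write $\mathrm{Pr}^{\rm L},\zeta^{\rm L},\zeta^{\rm NL}$ for the functions composed of all pieces. The LoS states of the links (given the positions), the thinning, and the fading gains, which are exponential with mean $1$, are independent of each other and across BSs. The typical UE is served by the BS $b_o\in\Phi$ with the largest path loss function value $\zeta$. With transmit power $P>0$ and noise power $P_{\rm N}\ge 0$, $$\mathrm{SINR}=\frac{P\,\zeta(b_o)\,h}{\sum_{b_i\in\tilde\Phi\setminus b_o}P\,\beta_i\,g_i+P_{\rm N}},\qquad p^{\rm cov}(\lambda,\rho,\gamma)=\Pr[\mathrm{SINR}>\gamma],$$ where $h,g_i$ are the fading gains and $\beta_i$ the path losses of the links. **Theorem (SINR invariance law).** If $L>0$, $0<\rho<\infty$ and $\gamma>0$, then $\lim_{\lambda\to\infty}p^{\rm cov}(\lambda,\rho,\gamma)$ exists and is a constant $c$ (independent of $\lambda$, and of $q$). If moreover LoS links of nearly minimal length are possible ($\mathrm{Pr}^{\rm L}_1(w)>0$ for some $w>L$ in the first piece, which is automatic if $\mathrm{Pr}^{\rm L}_1$ is strictly decreasing) and no link is stronger than an LoS link of minimal length ($\zeta^{\rm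 L}(w)\le\zeta^{\rm L}_1(L)$ and $\zeta^{\rm NL}(w)\le\zeta^{\rm L}_1(L)$ for all $w\ge L$), then, with $s=\gamma/(P\zeta^{\rm L}_1(L))$, $$c=\exp\Bigl(-\frac{P_{\rm N}\gamma}{P\zeta^{\rm L}_1(L)}\Bigr)\exp\Bigl(-2\pi\rho\int_0^\infty\frac{\mathrm{Pr}^{\rm L}(\sqrt{u^2+L^2})\,u}{1+\bigl(sP\zeta^{\rm L}(\sqrt{u^2+L^2})\bigr)^{-1}}\,du\Bigr)\exp\Bigl(-2\pi\rho\int_0^\infty\frac{\bigl[1-\mathrm{Pr}^{\rm L}(\sqrt{u^2+L^2})\bigr]u}{1+\bigl(sP\zeta^{\rm NL}(\sqrt{u^2+L^2})\bigr)^{-1}}\,du\Bigr),$$ where $e^{-\infty}=0$ if an integral diverges. -/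

import Mathlib

open MeasureTheory ProbabilityTheory Filter Topology
open scoped ENNReal NNReal

noncomputable section

namespace CellularNetwork

/-- The plane in which base stations are deployed. -/
abbrev Plane : Type := EuclideanSpace ℝ (Fin 2)

/-! ### Poisson point processes -/

/-- Number of points of the (enumerated) point configuration `X` that lie in `B`. -/
def pointCount {Ω E : Type*} (X : ℕ → Ω → E) (B : Set E) (ω : Ω) : ℕ∞ :=
  Set.encard {i : ℕ | X i ω ∈ B}

/-- The random points `X 0, X 1, …` form a Poisson point process with intensity measure `ν`:
the number of points in a measurable set of finite `ν`-measure is Poisson distributed with mean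
the measure of that set, and the numbers of points in disjoint measurable sets are independent.
(The enumeration by `ℕ` is no restriction if `ν` has infinite total mass.) -/
structure IsPoissonProcess {Ω E : Type*} [MeasurableSpace Ω] [MeasurableSpace E]
    (X : ℕ → Ω → E) (ν : Measure E) (μ : Measure Ω) : Prop where
  measurable : ∀ i, Measurable (X i)
  law : ∀ B : Set E, MeasurableSet B → ν B ≠ ∞ →
    μ.map (pointCount X B) = (poissonMeasure (ν B).toNNReal).map (fun k : ℕ => (k : ℕ∞))
  indep : ∀ (n : ℕ) (B : Fin n → Set E), (∀ k, MeasurableSet (B k)) →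
    Pairwise (fun k l => Disjoint (B k) (B l)) →
    iIndepFun (fun k => pointCount X (B k)) μ

/-! ### Path loss -/

/-- Index of the piece that contains the distance `w`: piece `0` is `w ≤ d 0`, piece `k` is
`d (k - 1) < w ≤ d k`, and the last piece is `d (m - 1) < w`. -/
def pieceIndex {m : ℕ} (d : Fin m → ℝ) (w : ℝ) : Fin (m + 1) :=
  ⟨(Finset.univ.filter (fun k : Fin m => d k < w)).card, by
    have h := Finset.card_le_univ (Finset.univ.filter (fun k : Fin m => d k < w))
    rw [Fintype.card_fin] at h
    omega⟩

/-- A path loss model with `m + 1` pieces for 3D distances `w ≥ L`. On piece `n` a link is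
line-of-sight (LoS) with probability `prL n w`, and has gain `AL n * w ^ (-αL n)` if it is LoS and
`ANL n * w ^ (-αNL n)` if it is non-line-of-sight (NLoS). -/
structure PathLoss (m : ℕ) (L : ℝ) where
  d : Fin m → ℝ
  AL : Fin (m + 1) → ℝ
  ANL : Fin (m + 1) → ℝ
  αL : Fin (m + 1) → ℝ
  αNL : Fin (m + 1) → ℝ
  prL : Fin (m + 1) → ℝ → ℝ
  d_strictMono : StrictMono d
  L_lt_d : ∀ k, L < d k
  AL_pos : ∀ n, 0 < AL n
  ANL_pos : ∀ n, 0 < ANL n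
  αL_pos : ∀ n, 0 < αL n
  αNL_pos : ∀ n, 0 < αNL n
  prL_mem : ∀ n w, L ≤ w → pieceIndex d w = n → prL n w ∈ Set.Icc (0 : ℝ) 1
  prL_antitone : ∀ n, AntitoneOn (prL n) {w | L ≤ w ∧ pieceIndex d w = n}

namespace PathLoss

variable {m : ℕ} {L : ℝ} (M : PathLoss m L)

/-- LoS path loss function of the `n`-th piece. -/
def pieceLoS (n : Fin (m + 1)) (w : ℝ) : ℝ := M.AL n * w ^ (-M.αL n)

/-- NLoS path loss function of the `n`-th piece. -/
def pieceNLoS (n : Fin (m + 1)) (w : ℝ) : ℝ := M.ANL n * w ^ (-M.αNL n)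

/-- The LoS path loss function (all pieces together). -/
def gainLoS (w : ℝ) : ℝ := M.pieceLoS (pieceIndex M.d w) w

/-- The NLoS path loss function (all pieces together). -/
def gainNLoS (w : ℝ) : ℝ := M.pieceNLoS (pieceIndex M.d w) w

/-- The LoS probability function (all pieces together). -/
def probLoS (w : ℝ) : ℝ := M.prL (pieceIndex M.d w) w

end PathLoss

/-- 3D distance of a link with 2D distance `r` and antenna height difference `L`. -/
def dist3D (L r : ℝ) : ℝ := Real.sqrt (r ^ 2 + L ^ 2)

/-! ### The network -/

/-- Density of the active base stations, for base station density `lam`, user density `ρ` and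
parameter `q`: `lam * (1 - 1 / (1 + ρ / (q * lam)) ^ q)`. -/
def activeDensity (q ρ lam : ℝ) : ℝ := lam * (1 - 1 / (1 + ρ / (q * lam)) ^ q)

/-- The random data of the network as seen from the typical user at the origin: for the `i`-th
base station its position `X i`, a number `U i` that decides whether its link to the typical user
is LoS, a number `V i` that decides whether it is active, and the fading gain `g i` of its link to
the typical user. -/
structure Deployment (Ω : Type*) where
  X : ℕ → Ω → Plane
  U : ℕ → Ω → ℝ
  V : ℕ → Ω → ℝ
  g : ℕ → Ω → ℝ

namespace Deployment

variable {Ω : Type*}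

/-- The base stations form a homogeneous Poisson point process of density `lam`. Independently of
their positions they carry independent, identically distributed marks, each consisting of two
numbers that are uniform on `[0, 1]` and of an exponential variable with mean one (Rayleigh
fading), these three being independent. -/
structure IsNetwork [MeasurableSpace Ω] (D : Deployment Ω) (lam : ℝ) (μ : Measure Ω) : Prop where
  poisson : IsPoissonProcess D.X (ENNReal.ofReal lam • (volume : Measure Plane)) μ
  measurable_U : ∀ i, Measurable (D.U i)
  measurable_V : ∀ i, Measurable (D.V i)
  measurable_g : ∀ i, Measurable (D.g i)
  mark_law : ∀ i, μ.map (fun ω => (D.U i ω, D.V i ω, D.g i ω)) =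
    ((volume : Measure ℝ).restrict (Set.Icc 0 1)).prod
      (((volume : Measure ℝ).restrict (Set.Icc 0 1)).prod (expMeasure 1))
  mark_iIndep : iIndepFun (fun i ω => (D.U i ω, D.V i ω, D.g i ω)) μ
  mark_indep : IndepFun (fun ω i => D.X i ω) (fun ω i => (D.U i ω, D.V i ω, D.g i ω)) μ

variable {m : ℕ} {L : ℝ} (D : Deployment Ω) (M : PathLoss m L)

/-- 3D distance between the `i`-th base station and the typical user. -/
def linkDist (_M : PathLoss m L) (i : ℕ) (ω : Ω) : ℝ := dist3D L ‖D.X i ω‖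

open Classical in
/-- Path loss between the `i`-th base station and the typical user. The link is LoS if
`U i ≤ Pr^L(w)`, which given the positions has probability `Pr^L(w)`. -/
def gain (i : ℕ) (ω : Ω) : ℝ :=
  if D.U i ω ≤ M.probLoS (D.linkDist M i ω) then M.gainLoS (D.linkDist M i ω)
  else M.gainNLoS (D.linkDist M i ω)

/-- The serving base station: the one with the largest path loss function value, that is, with the
largest average received power. (Almost surely there is exactly one.) -/
def serving (ω : Ω) : ℕ := sInf {i : ℕ | ∀ j, D.gain M j ω ≤ D.gain M i ω}

/-- The `i`-th base station is active. Since the `V i` are independent and uniform on `[0, 1]`, the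
active base stations are an independent thinning of all base stations, that is, a homogeneous
Poisson point process of density `activeDensity q ρ lam`. -/
def IsActive (q ρ lam : ℝ) (i : ℕ) (ω : Ω) : Prop := D.V i ω ≤ activeDensity q ρ lam / lam

open Classical in
/-- Aggregate interference: the total power received from all active base stations except the
serving one (possibly infinite). -/
def interference (P q ρ lam : ℝ) (ω : Ω) : ℝ≥0∞ :=
  ∑' i : ℕ, if i ≠ D.serving M ω ∧ D.IsActive q ρ lam i ω then
    ENNReal.ofReal (P * D.gain M i ω * D.g i ω) else 0

/-- Signal-to-interference-plus-noise ratio of the typical user. -/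
def sinr (P PN q ρ lam : ℝ) (ω : Ω) : ℝ≥0∞ :=
  ENNReal.ofReal (P * D.gain M (D.serving M ω) ω * D.g (D.serving M ω) ω) /
    (D.interference M P q ρ lam ω + ENNReal.ofReal PN)

/-- Coverage probability: the probability that the SINR exceeds the threshold `γ`. -/
def coverage [MeasurableSpace Ω] (μ : Measure Ω) (P PN q ρ γ lam : ℝ) : ℝ≥0∞ :=
  μ {ω | ENNReal.ofReal γ < D.sinr M P PN q ρ lam ω}

end Deployment

/-! ### The limit formula -/

namespace PathLoss

variable {m : ℕ} {L : ℝ} (M : PathLoss m L)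

/-- `∫₀^∞ Pr^L(w) u / (1 + (s P ζ^L(w))⁻¹) du` with `w = √(u² + L²)`. -/
def integralLoS (P s : ℝ) : ℝ≥0∞ :=
  ∫⁻ u in Set.Ioi (0 : ℝ), ENNReal.ofReal
    (M.probLoS (dist3D L u) * u / (1 + (s * P * M.gainLoS (dist3D L u))⁻¹))

/-- `∫₀^∞ (1 - Pr^L(w)) u / (1 + (s P ζ^NL(w))⁻¹) du` with `w = √(u² + L²)`. -/
def integralNLoS (P s : ℝ) : ℝ≥0∞ :=
  ∫⁻ u in Set.Ioi (0 : ℝ), ENNReal.ofReal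
    ((1 - M.probLoS (dist3D L u)) * u / (1 + (s * P * M.gainNLoS (dist3D L u))⁻¹))

/-- Limit of the Laplace transform of the interference,
`exp (-2πρ ∫ …) * exp (-2πρ ∫ …)`, where `exp (-∞) = 0`. -/
def laplaceLimit (P ρ s : ℝ) : ℝ≥0∞ :=
  EReal.exp (-((ENNReal.ofReal (2 * Real.pi * ρ) * M.integralLoS P s : ℝ≥0∞) : EReal)) *
    EReal.exp (-((ENNReal.ofReal (2 * Real.pi * ρ) * M.integralNLoS P s : ℝ≥0∞) : EReal))

/-- The limit formula of the coverage probability. -/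
def coverageLimit (P PN ρ γ : ℝ) : ℝ≥0∞ :=
  ENNReal.ofReal (Real.exp (-(PN * γ / (P * M.pieceLoS 0 L)))) *
    M.laplaceLimit P ρ (γ / (P * M.pieceLoS 0 L))

end PathLoss

end CellularNetwork

end

/-!
Which base station serves depends only on the positions and the LoS marks. Given those, the fading
gain of the serving link is a fresh exponential variable, so the coverage probability is an average
of Laplace transforms, at `γ / (P * z)` with `z` the serving path loss, of noise plus interference.
Counting the serving base station among the interferers costs at most the factor
`1 - p * (γ / (1 + γ))`, where `p = activeDensity q ρ lam / lam → 0`, and makes the transform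
explicit by the Laplace functional of a marked Poisson process: it depends on `lam` only through the
active density, which tends to `ρ`. Finally `z` is at most the essential supremum `maxGain` of the
path loss, and exceeds any smaller level with probability tending to `1`, since the number of links
above that level is Poisson with mean proportional to `lam`.
-/

noncomputable section

namespace CellularNetwork

/-- `exp (-a)` for an extended nonnegative real `a`, with `exp (-∞) = 0`: the form in which Laplace
transforms of possibly infinite interferences are written. -/
def expNeg (a : ℝ≥0∞) : ℝ≥0∞ := EReal.exp (-(a : EReal))

lemma expNeg_add (a b : ℝ≥0∞) : expNeg (a + b) = expNeg a * expNeg b := by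
  unfold expNeg
  rw [← EReal.exp_add, EReal.coe_ennreal_add, EReal.neg_add, sub_eq_add_neg]
  · exact .inl (EReal.coe_ennreal_ne_bot _)
  · exact .inr (EReal.coe_ennreal_ne_bot _)

lemma expNeg_ofReal {r : ℝ} (hr : 0 ≤ r) :
    expNeg (ENNReal.ofReal r) = ENNReal.ofReal (Real.exp (-r)) := by
  rw [expNeg, EReal.coe_ennreal_ofReal, max_eq_left hr, ← EReal.coe_neg, EReal.exp_coe]

@[simp] lemma expNeg_zero : expNeg 0 = 1 := by simp [expNeg]

@[simp] lemma expNeg_top : expNeg ∞ = 0 := by simp [expNeg]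

lemma expNeg_antitone : Antitone expNeg := fun _ _ h =>
  EReal.exp_monotone (EReal.neg_le_neg_iff.2 (EReal.coe_ennreal_le_coe_ennreal_iff.2 h))

lemma expNeg_le_one (a : ℝ≥0∞) : expNeg a ≤ 1 :=
  (expNeg_antitone zero_le).trans_eq expNeg_zero

lemma continuous_expNeg : Continuous expNeg :=
  ENNReal.continuous_exp.comp (continuous_neg.comp continuous_coe_ennreal_ereal)

@[fun_prop] lemma measurable_expNeg : Measurable expNeg := continuous_expNeg.measurable

lemma expNeg_sum {ι : Type*} (s : Finset ι) (a : ι → ℝ≥0∞) :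
    expNeg (∑ i ∈ s, a i) = ∏ i ∈ s, expNeg (a i) := by
  classical
  induction s using Finset.induction_on with
  | empty => simp
  | insert i s hi ih => rw [Finset.sum_insert hi, Finset.prod_insert hi, expNeg_add, ih]

lemma expNeg_nat_mul (n : ℕ) (a : ℝ≥0∞) : expNeg (n * a) = expNeg a ^ n := by
  simpa using expNeg_sum (Finset.range n) fun _ => a

lemma expNeg_neg_log {h : ℝ≥0∞} (hh : h ≤ 1) : expNeg (-ENNReal.log h).toENNReal = h := by
  have hlog : 0 ≤ -ENNReal.log h := by
    rw [← neg_zero, EReal.neg_le_neg_iff, ← ENNReal.log_one]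
    exact ENNReal.log_monotone hh
  rw [expNeg, EReal.coe_toENNReal hlog, neg_neg, ENNReal.exp_log]

lemma lintegral_expNeg_le_one {Ω : Type*} [MeasurableSpace Ω] (μ : Measure Ω)
    [IsProbabilityMeasure μ] (f : Ω → ℝ≥0∞) : ∫⁻ ω, expNeg (f ω) ∂μ ≤ 1 :=
  (lintegral_mono fun ω => expNeg_le_one (f ω)).trans_eq (by simp)

lemma lintegral_one_sub_expNeg {Ω : Type*} [MeasurableSpace Ω] {μ : Measure Ω}
    [IsProbabilityMeasure μ] {f : Ω → ℝ≥0∞} (hf : Measurable f) :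
    ∫⁻ ω, (1 - expNeg (f ω)) ∂μ = 1 - ∫⁻ ω, expNeg (f ω) ∂μ := by
  have hm : Measurable fun ω => expNeg (f ω) := measurable_expNeg.comp hf
  rw [lintegral_sub hm
    (ne_top_of_le_ne_top ENNReal.one_ne_top (lintegral_expNeg_le_one μ f))
    (ae_of_all _ fun ω => expNeg_le_one _), lintegral_one, measure_univ]

lemma tendsto_lintegral_expNeg {Ω : Type*} [MeasurableSpace Ω] {μ : Measure Ω} [IsFiniteMeasure μ]
    {f : ℕ → Ω → ℝ≥0∞} {g : Ω → ℝ≥0∞} (hf : ∀ n, Measurable (f n))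
    (h : ∀ ω, Tendsto (fun n => f n ω) atTop (𝓝 (g ω))) :
    Tendsto (fun n => ∫⁻ ω, expNeg (f n ω) ∂μ) atTop (𝓝 (∫⁻ ω, expNeg (g ω) ∂μ)) :=
  tendsto_lintegral_of_dominated_convergence (fun _ => 1)
    (fun n => measurable_expNeg.comp (hf n)) (fun n => ae_of_all _ fun ω => expNeg_le_one _)
    (by simp) (ae_of_all _ fun ω => (continuous_expNeg.tendsto _).comp (h ω))

section Independence

variable {Ω α β δ : Type*} [MeasurableSpace Ω] [MeasurableSpace α] [MeasurableSpace β]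
  [MeasurableSpace δ] {μ : Measure Ω}

lemma lintegral_expNeg_tsum_of_iIndepFun [IsProbabilityMeasure μ] {Y : ℕ → Ω → ℝ≥0∞}
    (hYm : ∀ i, Measurable (Y i)) (hY : iIndepFun Y μ) :
    ∫⁻ ω, expNeg (∑' i, Y i ω) ∂μ =
      expNeg (∑' i, (-ENNReal.log (∫⁻ ω, expNeg (Y i ω) ∂μ)).toENNReal) := by
  have hpartial (n : ℕ) : ∫⁻ ω, expNeg (∑ i ∈ Finset.range n, Y i ω) ∂μ =
      expNeg (∑ i ∈ Finset.range n, (-ENNReal.log (∫⁻ ω, expNeg (Y i ω) ∂μ)).toENNReal) := by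
    simp only [expNeg_sum, expNeg_neg_log (lintegral_expNeg_le_one μ _)]
    exact lintegral_prod_eq_prod_lintegral_of_indepFun _ (fun i ω => expNeg (Y i ω))
      (hY.comp (fun _ => expNeg) fun _ => measurable_expNeg)
      (fun i => measurable_expNeg.comp (hYm i))
  refine tendsto_nhds_unique (tendsto_lintegral_expNeg (fun n => by fun_prop)
    fun ω => ENNReal.tendsto_nat_tsum fun i => Y i ω) ?_
  simp only [hpartial]
  exact (continuous_expNeg.tendsto _).comp (ENNReal.tendsto_nat_tsum _)

lemma map_prodMk_prod_infinitePi {ι : Type*} (ν : ι → Measure α) (κ : ι → Measure β)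
    [∀ i, IsProbabilityMeasure (ν i)] [∀ i, IsProbabilityMeasure (κ i)] :
    ((Measure.infinitePi ν).prod (Measure.infinitePi κ)).map (fun p i => (p.1 i, p.2 i)) =
      Measure.infinitePi fun i => (ν i).prod (κ i) := by
  refine Measure.eq_infinitePi _ fun s t ht => ?_
  have hs : MeasurableSet (Set.pi (s : Set ι) t) := .pi s.countable_toSet fun i _ => ht i
  have hslice (u : ι → α) : Measure.infinitePi κ
      (Prod.mk u ⁻¹' ((fun (p : (ι → α) × (ι → β)) i => (p.1 i, p.2 i)) ⁻¹' Set.pi s t)) =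
      ∏ i ∈ s, κ i (Prod.mk (u i) ⁻¹' t i) :=
    Measure.infinitePi_pi κ (t := fun i => Prod.mk (u i) ⁻¹' t i)
      fun i _ => (ht i).preimage (by fun_prop)
  have hm (i : ι) : Measurable fun a => κ i (Prod.mk a ⁻¹' t i) :=
    measurable_measure_prodMk_left (ht i)
  rw [Measure.map_apply (by fun_prop) hs, Measure.prod_apply (hs.preimage (by fun_prop))]
  simp only [hslice]
  rw [lintegral_prod_eq_prod_lintegral_of_indepFun s
    (fun i (u : ι → α) => κ i (Prod.mk (u i) ⁻¹' t i))
    (iIndepFun_infinitePi hm) (fun i => (hm i).comp (measurable_pi_apply i))]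
  refine Finset.prod_congr rfl fun i _ => ?_
  rw [Measure.prod_apply (ht i)]
  exact (measurePreserving_eval_infinitePi ν i).lintegral_comp (hm i)

lemma indepFun_pi_of_iIndepFun_prodMk [IsProbabilityMeasure μ] {U : ℕ → Ω → α} {W : ℕ → Ω → β}
    (hU : ∀ i, Measurable (U i)) (hW : ∀ i, Measurable (W i))
    (h : iIndepFun (fun i ω => (U i ω, W i ω)) μ) (hUW : ∀ i, IndepFun (U i) (W i) μ) :
    IndepFun (fun ω i => U i ω) (fun ω i => W i ω) μ := by
  have hUp (i : ℕ) : IsProbabilityMeasure (μ.map (U i)) :=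
    Measure.isProbabilityMeasure_map (hU i).aemeasurable
  have hWp (i : ℕ) : IsProbabilityMeasure (μ.map (W i)) :=
    Measure.isProbabilityMeasure_map (hW i).aemeasurable
  have hUind : iIndepFun U μ := h.comp (fun _ => Prod.fst) fun _ => measurable_fst
  have hWind : iIndepFun W μ := h.comp (fun _ => Prod.snd) fun _ => measurable_snd
  rw [indepFun_iff_map_prod_eq_prod_map_map (by fun_prop) (by fun_prop),
    iIndepFun.map_fun_eq_infinitePi_map hU hUind, iIndepFun.map_fun_eq_infinitePi_map hW hWind]
  have hpairs : μ.map (fun ω i => (U i ω, W i ω)) =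
      Measure.infinitePi fun i => (μ.map (U i)).prod (μ.map (W i)) := by
    rw [iIndepFun.map_fun_eq_infinitePi_map (fun i => by fun_prop) h]
    congr! with i
    exact (indepFun_iff_map_prod_eq_prod_map_map (by fun_prop) (by fun_prop)).1 (hUW i)
  let unzip (p : ℕ → α × β) : (ℕ → α) × (ℕ → β) := (fun i => (p i).1, fun i => (p i).2)
  have hunzip : Measurable unzip := by fun_prop
  have hUW_meas : Measurable fun ω i => (U i ω, W i ω) := by fun_prop
  have hzip : Measurable fun (p : (ℕ → α) × (ℕ → β)) i => (p.1 i, p.2 i) := by fun_prop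
  calc μ.map (fun ω => (fun i => U i ω, fun i => W i ω))
      = (μ.map (fun ω i => (U i ω, W i ω))).map unzip := (Measure.map_map hunzip hUW_meas).symm
    _ = _ := by
      rw [hpairs, ← map_prodMk_prod_infinitePi, Measure.map_map hunzip hzip]
      exact Measure.map_id

lemma indepFun_prodMk_left_of_prodMk_right [IsFiniteMeasure μ] {X : Ω → α} {Y : Ω → β} {Z : Ω → δ}
    (hX : Measurable X) (hY : Measurable Y) (hZ : Measurable Z)
    (hXYZ : IndepFun X (fun ω => (Y ω, Z ω)) μ) (hYZ : IndepFun Y Z μ) :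
    IndepFun (fun ω => (X ω, Y ω)) Z μ := by
  rw [indepFun_iff_map_prod_eq_prod_map_map (by fun_prop) (by fun_prop)]
  have hXY : IndepFun X Y μ := hXYZ.comp measurable_id measurable_fst
  rw [indepFun_iff_map_prod_eq_prod_map_map (by fun_prop) (by fun_prop)] at hXYZ hYZ hXY
  rw [hXY, ← MeasurableEquiv.prodAssoc.map_measurableEquiv_injective.eq_iff,
    Measure.map_map MeasurableEquiv.prodAssoc.measurable ((hX.prodMk hY).prodMk hZ),
    Measure.prodAssoc_prod,
    ← hYZ, ← hXYZ]
  rfl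

end Independence

section Resampling

variable {Ω α β : Type*} [MeasurableSpace Ω] [MeasurableSpace α] [MeasurableSpace β]
  {μ : Measure Ω}

lemma measurable_update_prodMk {ι : Type*} [DecidableEq ι] (k : ι) :
    Measurable fun p : (ι → α) × α => Function.update p.1 k p.2 :=
  measurable_pi_lambda _ fun i => by
    by_cases h : i = k
    · subst h; simpa using measurable_snd
    · simp only [Function.update_of_ne h]; fun_prop

lemma map_update_prod_infinitePi {ι : Type*} [DecidableEq ι] (κ : ι → Measure α)
    [∀ i, IsProbabilityMeasure (κ i)] (k : ι) :
    ((Measure.infinitePi κ).prod (κ k)).map (fun p => Function.update p.1 k p.2) =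
      Measure.infinitePi κ := by
  refine Measure.eq_infinitePi _ fun s t ht => ?_
  have hs : MeasurableSet (Set.pi (s : Set ι) t) := .pi s.countable_toSet fun i _ => ht i
  have hpre : (fun p : (ι → α) × α => Function.update p.1 k p.2) ⁻¹' Set.pi s t =
      Set.pi ((s.erase k : Finset ι) : Set ι) t ×ˢ (if k ∈ s then t k else Set.univ) := by
    ext ⟨w, a⟩
    simp only [Set.mem_preimage, Set.mem_pi, Set.mem_prod, Finset.mem_coe, Finset.mem_erase]
    constructor
    · intro h
      refine ⟨fun i hi => by simpa [Function.update_of_ne hi.1] using h i hi.2, ?_⟩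
      split_ifs with hk
      · simpa using h k hk
      · trivial
    · rintro ⟨h', h⟩ i hi
      by_cases hik : i = k
      · subst hik; simpa [hi] using h
      · simpa [Function.update_of_ne hik] using h' i ⟨hik, hi⟩
  rw [Measure.map_apply (measurable_update_prodMk k) hs, hpre, Measure.prod_prod,
    Measure.infinitePi_pi _ fun i _ => ht i]
  split_ifs with hk
  · exact Finset.prod_erase_mul s (fun i => κ i (t i)) hk
  · rw [measure_univ, mul_one, Finset.erase_eq_of_notMem hk]

lemma lintegral_comp_prodMk_of_indepFun [IsFiniteMeasure μ] {Z : Ω → β} {W : Ω → α}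
    {f : β → α → ℝ≥0∞} (hZ : Measurable Z) (hW : Measurable W) (hf : Measurable f.uncurry)
    (hZW : IndepFun Z W μ) :
    ∫⁻ ω, f (Z ω) (W ω) ∂μ = ∫⁻ ω, ∫⁻ ω', f (Z ω) (W ω') ∂μ ∂μ :=
  calc ∫⁻ ω, f (Z ω) (W ω) ∂μ
      = ∫⁻ p, f.uncurry p ∂((μ.map Z).prod (μ.map W)) := by
        rw [← (indepFun_iff_map_prod_eq_prod_map_map hZ.aemeasurable hW.aemeasurable).1 hZW,
          lintegral_map hf (hZ.prodMk hW)]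
        rfl
    _ = ∫⁻ ω, ∫⁻ ω', f (Z ω) (W ω') ∂μ ∂μ := by
        rw [lintegral_prod _ hf.aemeasurable, lintegral_map hf.lintegral_prod_right' hZ]
        exact lintegral_congr fun ω => lintegral_map hf.of_uncurry_left hW

-- Conditionally on `Z`, the sequence `W` is i.i.d. and the index `K Z` is a constant.
lemma lintegral_update_of_indepFun [IsProbabilityMeasure μ] {Z : Ω → β} {W : ℕ → Ω → α}
    {κ : Measure α} [IsProbabilityMeasure κ] {K : β → ℕ} {f : β → (ℕ → α) → ℝ≥0∞}
    (hZ : Measurable Z) (hW : ∀ i, Measurable (W i)) (hK : Measurable K)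
    (hf : Measurable f.uncurry) (hZW : IndepFun Z (fun ω i => W i ω) μ)
    (hWind : iIndepFun W μ) (hWlaw : ∀ i, μ.map (W i) = κ) :
    ∫⁻ ω, f (Z ω) (fun i => W i ω) ∂μ =
      ∫⁻ ω, ∫⁻ a, f (Z ω) (Function.update (fun i => W i ω) (K (Z ω)) a) ∂κ ∂μ := by
  have hlaw : μ.map (fun ω i => W i ω) = Measure.infinitePi fun _ : ℕ => κ := by
    rw [iIndepFun.map_fun_eq_infinitePi_map hW hWind]
    simp only [hWlaw]
  have hupdate : Measurable fun p : (β × (ℕ → α)) × α => Function.update p.1.2 (K p.1.1) p.2 := by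
    have h : Measurable fun q : ℕ × ((ℕ → α) × α) => Function.update q.2.1 q.1 q.2.2 :=
      measurable_from_prod_countable_right measurable_update_prodMk
    have hK' : Measurable fun p : (β × (ℕ → α)) × α => (K p.1.1, (p.1.2, p.2)) := by fun_prop
    exact h.comp hK'
  have hresampled : Measurable (Function.uncurry fun z (w : ℕ → α) =>
      ∫⁻ a, f z (Function.update w (K z) a) ∂κ) :=
    Measurable.lintegral_prod_right' (f := fun p : (β × (ℕ → α)) × α =>
      f p.1.1 (Function.update p.1.2 (K p.1.1) p.2))
      (hf.comp ((measurable_fst.comp measurable_fst).prodMk hupdate))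
  rw [lintegral_comp_prodMk_of_indepFun hZ (by fun_prop) hf hZW,
    lintegral_comp_prodMk_of_indepFun hZ (by fun_prop) hresampled hZW]
  refine lintegral_congr fun ω => ?_
  have hsection : Measurable (f (Z ω)) := hf.of_uncurry_left
  rw [← lintegral_map hsection (by fun_prop),
    ← lintegral_map hresampled.of_uncurry_left (by fun_prop), hlaw]
  conv_lhs => rw [← map_update_prod_infinitePi (fun _ : ℕ => κ) (K (Z ω))]
  rw [lintegral_map hsection (measurable_update_prodMk _)]
  exact lintegral_prod _ (hsection.comp (measurable_update_prodMk _)).aemeasurable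

end Resampling

section Uniform

/-- The uniform distribution on `[0, 1]`, the law of the marks that decide on line of sight and on
activity. -/
def unif : Measure ℝ := (volume : Measure ℝ).restrict (Set.Icc 0 1)

instance : IsProbabilityMeasure unif := ⟨by simp [unif]⟩

lemma unif_Iic {p : ℝ} (hp : p ≤ 1) : unif (Set.Iic p) = ENNReal.ofReal p := by
  have hinter : Set.Iic p ∩ Set.Icc 0 1 = Set.Icc 0 p :=
    Set.ext fun x => ⟨fun h => ⟨h.2.1, h.1⟩, fun h => ⟨h.2, h.1, h.2.trans hp⟩⟩
  rw [unif, Measure.restrict_apply measurableSet_Iic, hinter, Real.volume_Icc, sub_zero]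

lemma lintegral_ite_le_unif {p : ℝ} (hp : p ∈ Set.Icc (0 : ℝ) 1) (a b : ℝ≥0∞) :
    ∫⁻ u, (if u ≤ p then a else b) ∂unif =
      ENNReal.ofReal p * a + ENNReal.ofReal (1 - p) * b := by
  have hsplit (u : ℝ) : (if u ≤ p then a else b) =
      (Set.Iic p).indicator (fun _ => a) u + (Set.Iic p)ᶜ.indicator (fun _ => b) u := by
    rcases le_or_gt u p with h | h <;> simp [h]
  simp only [hsplit]
  rw [lintegral_add_left (measurable_const.indicator measurableSet_Iic),
    lintegral_indicator_const measurableSet_Iic, lintegral_indicator_const measurableSet_Iic.compl,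
    prob_compl_eq_one_sub measurableSet_Iic, unif_Iic hp.2, ENNReal.ofReal_sub _ hp.1,
    ENNReal.ofReal_one, mul_comm a, mul_comm b]

end Uniform

section Exponential

instance : IsProbabilityMeasure (expMeasure 1) := isProbabilityMeasure_expMeasure one_pos

lemma expMeasure_Ioi {r x : ℝ} (hr : 0 < r) (hx : 0 ≤ x) :
    expMeasure r (Set.Ioi x) = ENNReal.ofReal (Real.exp (-(r * x))) := by
  have := isProbabilityMeasure_expMeasure hr
  have hcdf := cdf_expMeasure_eq hr x
  rw [if_pos hx, cdf_eq_real] at hcdf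
  rw [← Set.compl_Iic, prob_compl_eq_one_sub measurableSet_Iic, ← ofReal_measureReal, hcdf,
    ← ENNReal.ofReal_one, ← ENNReal.ofReal_sub _ (sub_nonneg.2 (Real.exp_le_one_iff.2
      (neg_nonpos.2 (by positivity)))), sub_sub_cancel]

lemma expMeasure_lt_mul_div {γ c : ℝ} (hγ : 0 < γ) (hc : 0 < c) (b : ℝ≥0∞) :
    expMeasure 1 {a | ENNReal.ofReal γ < ENNReal.ofReal (c * a) / b} =
      expNeg (ENNReal.ofReal (γ / c) * b) := by
  rcases eq_or_ne b ∞ with rfl | hb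
  · have hγc : ENNReal.ofReal (γ / c) ≠ 0 := by simpa using div_pos hγ hc
    simp [ENNReal.mul_top hγc]
  · lift b to ℝ≥0 using hb
    rw [← ENNReal.ofReal_coe_nnreal, ← ENNReal.ofReal_mul (by positivity),
      expNeg_ofReal (by positivity), ← one_mul (γ / c * b),
      ← expMeasure_Ioi one_pos (by positivity)]
    congr 1 with a
    rw [Set.mem_ofPred_eq, Set.mem_Ioi,
      ENNReal.lt_div_iff_mul_lt (.inr ENNReal.ofReal_ne_top) (.inl ENNReal.ofReal_ne_top),
      ← ENNReal.ofReal_mul hγ.le, ENNReal.ofReal_lt_ofReal_iff_of_nonneg (by positivity),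
      div_mul_eq_mul_div, div_lt_iff₀' hc]

lemma lintegral_expNeg_expMeasure {r c : ℝ} (hr : 0 < r) (hc : 0 ≤ c) :
    ∫⁻ a, expNeg (ENNReal.ofReal (c * a)) ∂(expMeasure r) = ENNReal.ofReal (r / (r + c)) := by
  have hdensity (a : ℝ) : (exponentialPDF r * fun a => expNeg (ENNReal.ofReal (c * a))) a =
      ENNReal.ofReal (r / (r + c)) * exponentialPDF (r + c) a := by
    rw [Pi.mul_apply]
    rcases lt_or_ge a 0 with ha | ha
    · simp [exponentialPDF_of_neg ha]
    · rw [exponentialPDF_of_nonneg ha, exponentialPDF_of_nonneg ha, expNeg_ofReal (by positivity),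
        ← ENNReal.ofReal_mul (by positivity), ← ENNReal.ofReal_mul (by positivity), mul_assoc,
        ← Real.exp_add, ← mul_assoc, div_mul_cancel₀ r (by positivity)]
      ring_nf
  have hm (r : ℝ) : Measurable (exponentialPDF r) :=
    (measurable_exponentialPDFReal r).ennreal_ofReal
  rw [show expMeasure r = volume.withDensity (exponentialPDF r) from rfl,
    lintegral_withDensity_eq_lintegral_mul _ (hm r) (by fun_prop)]
  simp only [hdensity]
  rw [lintegral_const_mul _ (hm _), lintegral_exponentialPDF_eq_one (by positivity), mul_one]

end Exponential

section Fading

/-- Law of the pair that consists of the activity mark and of the fading gain of a link. -/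
def fadingLaw : Measure (ℝ × ℝ) := unif.prod (expMeasure 1)

instance : IsProbabilityMeasure fadingLaw := by unfold fadingLaw; infer_instance

lemma fadingLaw_lt_mul_snd_div {γ c : ℝ} (hγ : 0 < γ) (hc : 0 < c) (b : ℝ≥0∞) :
    fadingLaw {w | ENNReal.ofReal γ < ENNReal.ofReal (c * w.2) / b} =
      expNeg (ENNReal.ofReal (γ / c) * b) := by
  have hmeas : MeasurableSet {g | ENNReal.ofReal γ < ENNReal.ofReal (c * g) / b} :=
    measurableSet_lt measurable_const (by fun_prop)
  rw [← expMeasure_lt_mul_div hγ hc b]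
  exact measurePreserving_snd.measure_preimage hmeas.nullMeasurableSet

open Classical in
/-- Power received over a link of mean power `c` with activity mark and fading gain `w`, where
transmitters are active with probability `p`. -/
def activePower (p c : ℝ) (w : ℝ × ℝ) : ℝ≥0∞ :=
  if w.1 ≤ p then ENNReal.ofReal (c * w.2) else 0

@[fun_prop] lemma measurable_activePower (p : ℝ) :
    Measurable fun x : ℝ × (ℝ × ℝ) => activePower p x.1 x.2 :=
  Measurable.ite (measurableSet_le (by fun_prop) measurable_const) (by fun_prop) measurable_const

lemma lintegral_expNeg_activePower {p b c : ℝ} (hp : p ∈ Set.Icc (0 : ℝ) 1) (hb : 0 ≤ b)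
    (hc : 0 ≤ c) :
    ∫⁻ w, expNeg (ENNReal.ofReal b * activePower p c w) ∂fadingLaw =
      ENNReal.ofReal (1 - p * (b * c / (1 + b * c))) := by
  have hinner (v : ℝ) :
      ∫⁻ g, expNeg (ENNReal.ofReal b * activePower p c (v, g)) ∂(expMeasure 1) =
        if v ≤ p then ENNReal.ofReal (1 / (1 + b * c)) else 1 := by
    unfold activePower
    split_ifs
    · simp only [← ENNReal.ofReal_mul hb, ← mul_assoc]
      exact lintegral_expNeg_expMeasure one_pos (by positivity)
    · simp
  rw [fadingLaw, lintegral_prod _ (Measurable.aemeasurable (by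
    have := (measurable_activePower p).comp (measurable_const (a := c) |>.prodMk measurable_id)
    exact measurable_expNeg.comp (this.const_mul _)))]
  simp only [hinner]
  have hp' := sub_nonneg.2 hp.2
  rw [lintegral_ite_le_unif hp, mul_one, ← ENNReal.ofReal_mul hp.1,
    ← ENNReal.ofReal_add (mul_nonneg hp.1 (by positivity)) hp']
  congr 1
  field_simp
  ring

end Fading

section PoissonProcess

lemma lintegral_expNeg_mul_poissonMeasure (r : ℝ≥0) (a : ℝ≥0∞) :
    ∫⁻ n, expNeg (n * a) ∂(poissonMeasure r) = expNeg (r * (1 - expNeg a)) := by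
  simp only [expNeg_nat_mul]
  have hle : expNeg a ≤ 1 := expNeg_le_one a
  generalize expNeg a = b at hle
  lift b to ℝ≥0 using ne_top_of_le_ne_top ENNReal.one_ne_top hle
  have hb : (b : ℝ) ≤ 1 := by exact_mod_cast hle
  have hseries := (NormedSpace.expSeries_div_hasSum_exp ((r : ℝ) * b)).mul_left (Real.exp (-r))
  rw [← Real.exp_eq_exp_ℝ, ← Real.exp_add, neg_add_eq_sub] at hseries
  have hexponent : (r : ℝ≥0∞) * (1 - b) = ENNReal.ofReal (r - r * b) := by
    rw [← mul_one_sub, ENNReal.ofReal_mul r.coe_nonneg, ENNReal.ofReal_sub _ b.coe_nonneg]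
    simp
  rw [hexponent, expNeg_ofReal (sub_nonneg.2 (mul_le_of_le_one_right r.coe_nonneg hb)),
    poissonMeasure, lintegral_sum_measure, neg_sub]
  simp only [lintegral_smul_measure, lintegral_dirac]
  rw [← hseries.tsum_eq, ENNReal.ofReal_tsum_of_nonneg (fun n => by positivity) hseries.summable]
  refine tsum_congr fun n => ?_
  rw [smul_eq_mul, ← ENNReal.ofReal_coe_nnreal, ← ENNReal.ofReal_pow b.coe_nonneg,
    ← ENNReal.ofReal_mul (by positivity)]
  congr 1
  ring

variable {Ω E : Type*} [MeasurableSpace Ω] [MeasurableSpace E] {X : ℕ → Ω → E} {ν : Measure E}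
  {μ : Measure Ω}

lemma pointCount_eq_tsum_indicator {Ω E : Type*} (X : ℕ → Ω → E) (B : Set E) (ω : Ω) :
    (pointCount X B ω : ℝ≥0∞) = ∑' i, B.indicator 1 (X i ω) := by
  rw [pointCount, ← ENNReal.tsum_set_one]
  exact tsum_subtype {i | X i ω ∈ B} 1

lemma measurable_pointCount (hX : ∀ i, Measurable (X i)) {B : Set E} (hB : MeasurableSet B) :
    Measurable (pointCount X B) := by
  have hcount : Measurable fun ω => (pointCount X B ω : ℝ≥0∞) := by
    simp only [pointCount_eq_tsum_indicator]
    exact Measurable.tsum fun i => (measurable_one.indicator hB).comp (hX i)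
  refine measurable_to_countable' fun n => ?_
  have hpre : pointCount X B ⁻¹' {n} = (fun ω => (pointCount X B ω : ℝ≥0∞)) ⁻¹' {(n : ℝ≥0∞)} := by
    ext ω
    simp
  rw [hpre]
  exact hcount (measurableSet_singleton _)

lemma IsPoissonProcess.ae_pointCount_lt_top (hX : IsPoissonProcess X ν μ) {B : Set E}
    (hB : MeasurableSet B) (hν : ν B ≠ ∞) : ∀ᵐ ω ∂μ, pointCount X B ω < ⊤ := by
  have hlaw : ∀ᵐ n ∂(μ.map (pointCount X B)), n < ⊤ := by
    rw [hX.law B hB hν, ae_map_iff (by fun_prop) .of_discrete]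
    exact ae_of_all _ ENat.natCast_lt_top
  exact ae_of_ae_map (measurable_pointCount hX.measurable hB).aemeasurable hlaw

lemma IsPoissonProcess.lintegral_expNeg_pointCount_mul (hX : IsPoissonProcess X ν μ) {B : Set E}
    (hB : MeasurableSet B) (hν : ν B ≠ ∞) (a : ℝ≥0∞) :
    ∫⁻ ω, expNeg (pointCount X B ω * a) ∂μ = expNeg (ν B * (1 - expNeg a)) := by
  have hm : Measurable fun n : ℕ∞ => expNeg (n * a) := measurable_from_top
  rw [← lintegral_map hm (measurable_pointCount hX.measurable hB), hX.law B hB hν,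
    lintegral_map hm (by fun_prop)]
  simpa [ENNReal.coe_toNNReal hν] using lintegral_expNeg_mul_poissonMeasure (ν B).toNNReal a

lemma IsPoissonProcess.iIndepFun_pointCount (hX : IsPoissonProcess X ν μ) {ι : Type*} [Finite ι]
    {B : ι → Set E} (hB : ∀ k, MeasurableSet (B k))
    (hdisj : Pairwise fun k l => Disjoint (B k) (B l)) :
    iIndepFun (fun k => pointCount X (B k)) μ := by
  let e := Finite.equivFin ι
  have h := hX.indep _ (fun k => B (e.symm k)) (fun k => hB _)
    fun k l hkl => hdisj (e.symm.injective.ne hkl)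
  simpa using h.precomp e.injective

lemma tsum_simpleFunc_eq_sum_pointCount {Ω : Type*} (X : ℕ → Ω → E)
    (φ : SimpleFunc E ℝ≥0∞) (ω : Ω) :
    ∑' i, φ (X i ω) = ∑ c ∈ φ.range.filter (· ≠ 0), pointCount X (φ ⁻¹' {c}) ω * c := by
  have hpoint (x : E) : φ x = ∑ c ∈ φ.range.filter (· ≠ 0), (φ ⁻¹' {c}).indicator 1 x * c := by
    rw [Finset.sum_filter_of_ne (p := (· ≠ 0)) fun c _ h => right_ne_zero_of_mul h,
      Finset.sum_eq_single_of_mem (φ x) (φ.mem_range_self x)]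
    · simp
    · intro c _ hc
      simp [hc.symm]
  simp only [pointCount_eq_tsum_indicator, ← ENNReal.tsum_mul_right]
  rw [← Summable.tsum_finsetSum fun _ _ => ENNReal.summable]
  exact tsum_congr fun i => hpoint _

lemma IsPoissonProcess.lintegral_expNeg_tsum_simpleFunc (hX : IsPoissonProcess X ν μ)
    {φ : SimpleFunc E ℝ≥0∞} (hφ : φ.FinMeasSupp ν) :
    ∫⁻ ω, expNeg (∑' i, φ (X i ω)) ∂μ = expNeg (∫⁻ x, (1 - expNeg (φ x)) ∂ν) := by
  classical
  set s := φ.range.filter (· ≠ 0) with hs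
  have hfin (c : s) : ν (φ ⁻¹' {(c : ℝ≥0∞)}) ≠ ∞ :=
    (hφ.meas_preimage_singleton_ne_zero (Finset.mem_filter.1 c.2).2).ne
  have hindep : iIndepFun (fun c : s => pointCount X (φ ⁻¹' {(c : ℝ≥0∞)})) μ :=
    hX.iIndepFun_pointCount (fun c => φ.measurableSet_fiber _) fun c c' hcc' =>
      Disjoint.preimage _ (Set.disjoint_singleton.2 (Subtype.coe_injective.ne hcc'))
  have hm (c : ℝ≥0∞) : Measurable fun n : ℕ∞ => expNeg (n * c) := measurable_from_top
  have hintegral : ∫⁻ x, (1 - expNeg (φ x)) ∂ν =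
      ∑ c ∈ s, ν (φ ⁻¹' {c}) * (1 - expNeg c) := by
    have hmap : ∫⁻ x, (φ.map fun c => 1 - expNeg c) x ∂ν = _ :=
      (SimpleFunc.lintegral_eq_lintegral _ ν).trans (SimpleFunc.map_lintegral _ φ)
    simp only [SimpleFunc.map_apply] at hmap
    rw [hmap, hs, Finset.sum_filter_of_ne]
    · exact Finset.sum_congr rfl fun c _ => mul_comm _ _
    · rintro c - h rfl
      simp at h
  simp only [tsum_simpleFunc_eq_sum_pointCount, hintegral, expNeg_sum, ← hs]
  simp only [← Finset.prod_coe_sort s]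
  simp only [← hX.lintegral_expNeg_pointCount_mul (φ.measurableSet_fiber _) (hfin _)]
  exact lintegral_prod_eq_prod_lintegral_of_indepFun _ _ (hindep.comp _ fun c => hm c)
    fun c => (hm c).comp (measurable_pointCount hX.measurable (φ.measurableSet_fiber _))

lemma exists_simpleFunc_finMeasSupp_tendsto [SigmaFinite ν] {F : E → ℝ≥0∞} (hF : Measurable F) :
    ∃ φ : ℕ → SimpleFunc E ℝ≥0∞, (∀ n, (φ n).FinMeasSupp ν) ∧
      Monotone (fun n => (φ n : E → ℝ≥0∞)) ∧ ∀ x, Tendsto (fun n => φ n x) atTop (𝓝 (F x)) := by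
  let φ (n : ℕ) := (SimpleFunc.eapprox F n).restrict (spanningSets ν n)
  have hφ (n : ℕ) (x : E) :
      φ n x = (spanningSets ν n).indicator (SimpleFunc.eapprox F n) x :=
    SimpleFunc.restrict_apply _ (measurableSet_spanningSets ν n) x
  refine ⟨φ, fun n => ?_, fun n n' h x => ?_, fun x => ?_⟩
  · exact SimpleFunc.finMeasSupp_iff_support.2 <|
      (measure_mono fun x hx => by
        by_contra hx'
        exact hx (by rw [hφ, Set.indicator_of_notMem hx'])).trans_lt
      (measure_spanningSets_lt_top ν n)
  · simp only [hφ]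
    exact (Set.indicator_le_indicator_of_subset (monotone_spanningSets ν h)
      (fun _ => zero_le) x).trans (Set.indicator_le_indicator (SimpleFunc.monotone_eapprox F h x))
  · have heq : (fun n => φ n x) =ᶠ[atTop] fun n => SimpleFunc.eapprox F n x := by
      filter_upwards [eventually_ge_atTop (spanningSetsIndex ν x)] with n hn
      rw [hφ, Set.indicator_of_mem (monotone_spanningSets ν hn (mem_spanningSetsIndex ν x))]
    exact (SimpleFunc.tendsto_eapprox hF x).congr' heq.symm

lemma tendsto_tsum_of_monotone {f : ℕ → ℕ → ℝ≥0∞} {g : ℕ → ℝ≥0∞} (hf : Monotone f)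
    (h : ∀ i, Tendsto (fun n => f n i) atTop (𝓝 (g i))) :
    Tendsto (fun n => ∑' i, f n i) atTop (𝓝 (∑' i, g i)) := by
  simp only [← lintegral_count]
  exact lintegral_tendsto_of_tendsto_of_monotone (fun n => measurable_from_top.aemeasurable)
    (ae_of_all _ fun i _ _ hn => hf hn i) (ae_of_all _ h)

theorem IsPoissonProcess.lintegral_expNeg_tsum [SigmaFinite ν] [IsFiniteMeasure μ]
    (hX : IsPoissonProcess X ν μ) {F : E → ℝ≥0∞} (hF : Measurable F) :
    ∫⁻ ω, expNeg (∑' i, F (X i ω)) ∂μ = expNeg (∫⁻ x, (1 - expNeg (F x)) ∂ν) := by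
  obtain ⟨φ, hφ, hmono, hlim⟩ := exists_simpleFunc_finMeasSupp_tendsto (ν := ν) hF
  have hXm := hX.measurable
  have hleft := tendsto_lintegral_expNeg (μ := μ) (f := fun n ω => ∑' i, φ n (X i ω))
    (fun n => Measurable.tsum fun i => (φ n).measurable.comp (hXm i))
    fun ω => tendsto_tsum_of_monotone (fun n n' h i => hmono h (X i ω)) fun i => hlim (X i ω)
  simp only [hX.lintegral_expNeg_tsum_simpleFunc (hφ _)] at hleft
  refine tendsto_nhds_unique hleft ((continuous_expNeg.tendsto _).comp ?_)
  refine lintegral_tendsto_of_tendsto_of_monotone (fun n => ?_) (ae_of_all _ fun x => ?_)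
    (ae_of_all _ fun x => ?_)
  · exact (measurable_const.sub (measurable_expNeg.comp (φ n).measurable)).aemeasurable
  · exact fun n n' h => tsub_le_tsub_left (expNeg_antitone (hmono h x)) 1
  · exact ENNReal.Tendsto.sub tendsto_const_nhds ((continuous_expNeg.tendsto _).comp (hlim x))
      (.inl ENNReal.one_ne_top)

theorem IsPoissonProcess.lintegral_expNeg_tsum_marked [SigmaFinite ν] [IsProbabilityMeasure μ]
    (hX : IsPoissonProcess X ν μ) {α : Type*} [MeasurableSpace α] {κ : Measure α}
    [IsProbabilityMeasure κ] {Y : ℕ → Ω → α} (hY : ∀ i, Measurable (Y i))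
    (hXY : IndepFun (fun ω i => X i ω) (fun ω i => Y i ω) μ) (hYind : iIndepFun Y μ)
    (hYlaw : ∀ i, μ.map (Y i) = κ) {F : E × α → ℝ≥0∞} (hF : Measurable F) :
    ∫⁻ ω, expNeg (∑' i, F (X i ω, Y i ω)) ∂μ = expNeg (∫⁻ z, (1 - expNeg (F z)) ∂(ν.prod κ)) := by
  -- Averaging over the marks replaces `F` by the function `G` of the position.
  let h (x : E) : ℝ≥0∞ := ∫⁻ y, expNeg (F (x, y)) ∂κ
  let G (x : E) : ℝ≥0∞ := (-ENNReal.log (h x)).toENNReal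
  have hFexp : Measurable fun z => expNeg (F z) := measurable_expNeg.comp hF
  have hhm : Measurable h := hFexp.lintegral_prod_right'
  have hG (x : E) : expNeg (G x) = h x := expNeg_neg_log (lintegral_expNeg_le_one κ _)
  have hGm : Measurable G := hhm.ennreal_log.neg.ereal_toENNReal
  have hXm := hX.measurable
  have hsection (x : E) : Measurable fun y => F (x, y) := hF.comp (by fun_prop)
  have hmarks (x : ℕ → E) :
      ∫⁻ ω, expNeg (∑' i, F (x i, Y i ω)) ∂μ = expNeg (∑' i, G (x i)) := by
    have hlog (i : ℕ) : (-ENNReal.log (∫⁻ ω, expNeg (F (x i, Y i ω)) ∂μ)).toENNReal = G (x i) := by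
      have hexp : Measurable fun y => expNeg (F (x i, y)) := measurable_expNeg.comp (hsection _)
      rw [← lintegral_map hexp (hY i), hYlaw i]
    simpa only [Function.comp_apply, hlog] using lintegral_expNeg_tsum_of_iIndepFun
      (fun i => (hsection (x i)).comp (hY i))
      (hYind.comp (fun i y => F (x i, y)) fun i => hsection _)
  have hsum : Measurable (Function.uncurry fun (x : ℕ → E) (y : ℕ → α) =>
      expNeg (∑' i, F (x i, y i))) :=
    measurable_expNeg.comp (Measurable.tsum fun i => hF.comp (by fun_prop))
  calc ∫⁻ ω, expNeg (∑' i, F (X i ω, Y i ω)) ∂μ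
      = ∫⁻ ω, ∫⁻ ω', expNeg (∑' i, F (X i ω, Y i ω')) ∂μ ∂μ :=
        lintegral_comp_prodMk_of_indepFun (by fun_prop) (by fun_prop) hsum hXY
    _ = ∫⁻ ω, expNeg (∑' i, G (X i ω)) ∂μ := lintegral_congr fun ω => hmarks fun i => X i ω
    _ = expNeg (∫⁻ x, (1 - h x) ∂ν) := by simp only [hX.lintegral_expNeg_tsum hGm, hG]
    _ = expNeg (∫⁻ z, (1 - expNeg (F z)) ∂(ν.prod κ)) := by
        rw [lintegral_prod _ (hFexp.const_sub 1).aemeasurable]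
        simp only [lintegral_one_sub_expNeg (hsection _), h]

end PoissonProcess

section RadialIntegration

lemma lintegral_norm_addHaar {E : Type*} [NormedAddCommGroup E] [NormedSpace ℝ E]
    [FiniteDimensional ℝ E] [Nontrivial E] [MeasurableSpace E] [BorelSpace E] (μ : Measure E)
    [μ.IsAddHaarMeasure] {f : ℝ → ℝ≥0∞} (hf : Measurable f) :
    ∫⁻ x, f ‖x‖ ∂μ = Module.finrank ℝ E * μ (Metric.ball 0 1) *
      ∫⁻ r in Set.Ioi (0 : ℝ), ENNReal.ofReal (r ^ (Module.finrank ℝ E - 1)) * f r := by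
  set k := Module.finrank ℝ E - 1
  have hf' : Measurable fun r : Set.Ioi (0 : ℝ) => f r := hf.comp measurable_subtype_coe
  have hsnd : Measurable fun p : Metric.sphere (0 : E) 1 × Set.Ioi (0 : ℝ) => f p.2 :=
    hf'.comp measurable_snd
  calc ∫⁻ x, f ‖x‖ ∂μ
      = ∫⁻ x : ({0}ᶜ : Set E), f ‖x.1‖ ∂(μ.comap (↑)) := by
        rw [lintegral_subtype_comap (measurableSet_singleton _).compl fun x => f ‖x‖,
          restrict_compl_singleton]
    _ = ∫⁻ p, f p.2 ∂(μ.toSphere.prod (.volumeIoiPow k)) := by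
        simpa using μ.measurePreserving_homeomorphUnitSphereProd.lintegral_comp
          (f := fun p => f p.2) hsnd
    _ = μ.toSphere Set.univ * ∫⁻ r, f r ∂(.volumeIoiPow k) := by
        rw [lintegral_prod _ hsnd.aemeasurable, mul_comm]
        exact lintegral_const (∫⁻ r, f r ∂(.volumeIoiPow k))
    _ = _ := by
        rw [μ.toSphere_apply_univ, Measure.volumeIoiPow,
          lintegral_withDensity_eq_lintegral_mul _ (by fun_prop) hf',
          ← lintegral_subtype_comap measurableSet_Ioi]
        rfl

lemma lintegral_norm_plane {f : ℝ → ℝ≥0∞} (hf : Measurable f) :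
    ∫⁻ x : Plane, f ‖x‖ =
      ENNReal.ofReal (2 * Real.pi) * ∫⁻ r in Set.Ioi (0 : ℝ), ENNReal.ofReal r * f r := by
  rw [lintegral_norm_addHaar volume hf, EuclideanSpace.volume_ball_fin_two]
  simp [ENNReal.ofReal_mul]

end RadialIntegration

section PathLossFunctions

lemma le_dist3D (L r : ℝ) : L ≤ dist3D L r := Real.le_sqrt_of_sq_le (by nlinarith [sq_nonneg r])

lemma le_dist3D_self (L r : ℝ) : r ≤ dist3D L r :=
  Real.le_sqrt_of_sq_le (by nlinarith [sq_nonneg L])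

lemma continuous_dist3D (L : ℝ) : Continuous (dist3D L) := by unfold dist3D; fun_prop

lemma dist3D_zero {L : ℝ} (hL : 0 ≤ L) : dist3D L 0 = L := by simp [dist3D, Real.sqrt_sq hL]

variable {m : ℕ} (d : Fin m → ℝ) (A α : Fin (m + 1) → ℝ)

lemma pieceIndex_mono : Monotone (pieceIndex d) := fun _ _ h =>
  Fin.mk_le_mk.2 <| Finset.card_le_card <| Finset.monotone_filter_right _ fun _ _ hk =>
    lt_of_lt_of_le hk h

lemma measurable_pieceIndex : Measurable (pieceIndex d) := (pieceIndex_mono d).measurable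

lemma eventually_pieceIndex_eq_last : ∀ᶠ w in atTop, pieceIndex d w = Fin.last m := by
  have h : ∀ᶠ w in atTop, ∀ k, d k < w := eventually_all.2 fun k => eventually_gt_atTop (d k)
  filter_upwards [h] with w hw
  ext
  simp [pieceIndex, Finset.filter_true_of_mem fun k _ => hw k]

/-- The path loss function with gain `A n * w ^ (-α n)` on the `n`-th piece, of which the LoS and
the NLoS path loss are the two instances. -/
def piecewisePowerLaw (w : ℝ) : ℝ := A (pieceIndex d w) * w ^ (-α (pieceIndex d w))

lemma measurable_piecewisePowerLaw : Measurable (piecewisePowerLaw d A α) := by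
  have h (B : Fin (m + 1) → ℝ) : Measurable fun w => B (pieceIndex d w) :=
    (measurable_of_finite B).comp (measurable_pieceIndex d)
  exact (h A).mul (measurable_id.pow (h α).neg)

variable {A α}

lemma piecewisePowerLaw_pos (hA : ∀ n, 0 < A n) {w : ℝ} (hw : 0 < w) :
    0 < piecewisePowerLaw d A α w :=
  mul_pos (hA _) (Real.rpow_pos_of_pos hw _)

lemma exists_piecewisePowerLaw_le (hA : ∀ n, 0 ≤ A n) (hα : ∀ n, 0 ≤ α n) {L : ℝ} (hL : 0 < L) :
    ∃ G, ∀ w, L ≤ w → piecewisePowerLaw d A α w ≤ G := by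
  obtain ⟨G, hG⟩ := (Set.finite_range fun n => A n * L ^ (-α n)).bddAbove
  refine ⟨G, fun w hw => le_trans ?_ (hG (Set.mem_range_self (pieceIndex d w)))⟩
  exact mul_le_mul_of_nonneg_left
    (Real.rpow_le_rpow_of_nonpos hL hw (neg_nonpos.2 (hα _))) (hA _)

lemma tendsto_piecewisePowerLaw (hα : ∀ n, 0 < α n) :
    Tendsto (piecewisePowerLaw d A α) atTop (𝓝 0) := by
  have h : Tendsto (fun w => A (Fin.last m) * w ^ (-α (Fin.last m))) atTop (𝓝 0) := by
    simpa using (tendsto_rpow_neg_atTop (hα (Fin.last m))).const_mul (A (Fin.last m))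
  refine h.congr' ?_
  filter_upwards [eventually_pieceIndex_eq_last d] with w hw
  rw [piecewisePowerLaw, hw]

end PathLossFunctions

/-- Distribution of the position and the line-of-sight mark of a base station, up to the density of
the base stations. -/
abbrev linkMeasure : Measure (Plane × ℝ) := (volume : Measure Plane).prod unif

instance : (ae linkMeasure).NeBot := by
  refine ae_neBot.2 fun h => NeZero.ne (volume : Measure Plane) ?_
  simpa using congrArg (Measure.map Prod.fst) h

namespace PathLoss

variable {m : ℕ} {L : ℝ} (M : PathLoss m L)

lemma probLoS_mem (r : ℝ) : M.probLoS (dist3D L r) ∈ Set.Icc (0 : ℝ) 1 :=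
  M.prL_mem _ _ (le_dist3D L r) rfl

lemma measurable_probLoS_dist3D : Measurable fun r => M.probLoS (dist3D L r) := by
  refine measurable_of_Ici fun c => ?_
  have hpieces : (fun r => M.probLoS (dist3D L r)) ⁻¹' Set.Ici c = dist3D L ⁻¹' ⋃ n,
      {w | (L ≤ w ∧ pieceIndex M.d w = n) ∧ c ≤ M.prL n w} := by
    ext r
    simp [probLoS, le_dist3D L r]
  rw [hpieces]
  refine (MeasurableSet.iUnion fun n => Set.OrdConnected.measurableSet ⟨?_⟩).preimage
    (continuous_dist3D L).measurable
  rintro a ⟨⟨ha, ha'⟩, _⟩ b ⟨⟨hb, hb'⟩, hbc⟩ x ⟨hax, hxb⟩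
  have hx : L ≤ x ∧ pieceIndex M.d x = n := ⟨ha.trans hax, le_antisymm
    ((pieceIndex_mono M.d hxb).trans_eq hb') (ha'.symm.trans_le (pieceIndex_mono M.d hax))⟩
  exact ⟨hx, hbc.trans (M.prL_antitone n hx ⟨hb, hb'⟩ hxb)⟩

lemma measurable_gainLoS : Measurable M.gainLoS := measurable_piecewisePowerLaw M.d M.AL M.αL

lemma measurable_gainNLoS : Measurable M.gainNLoS := measurable_piecewisePowerLaw M.d M.ANL M.αNL

lemma gainLoS_pos {w : ℝ} (hw : 0 < w) : 0 < M.gainLoS w := piecewisePowerLaw_pos M.d M.AL_pos hw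

lemma gainNLoS_pos {w : ℝ} (hw : 0 < w) : 0 < M.gainNLoS w :=
  piecewisePowerLaw_pos M.d M.ANL_pos hw

open Classical in
/-- Path loss of the link to a base station at position `a.1` with line-of-sight mark `a.2`. -/
def linkGain (a : Plane × ℝ) : ℝ :=
  if a.2 ≤ M.probLoS (dist3D L ‖a.1‖) then M.gainLoS (dist3D L ‖a.1‖)
  else M.gainNLoS (dist3D L ‖a.1‖)

lemma linkGain_eq_or (a : Plane × ℝ) : M.linkGain a = M.gainLoS (dist3D L ‖a.1‖) ∨
    M.linkGain a = M.gainNLoS (dist3D L ‖a.1‖) :=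
  ite_eq_or_eq _ _ _

@[fun_prop] lemma measurable_linkGain : Measurable M.linkGain := by
  have hnorm : Measurable fun a : Plane × ℝ => ‖a.1‖ := by fun_prop
  have hdist : Measurable fun a : Plane × ℝ => dist3D L ‖a.1‖ :=
    (continuous_dist3D L).measurable.comp hnorm
  exact Measurable.ite
    (measurableSet_le measurable_snd (M.measurable_probLoS_dist3D.comp hnorm))
    (M.measurable_gainLoS.comp hdist) (M.measurable_gainNLoS.comp hdist)

lemma linkGain_pos (hL : 0 < L) (a : Plane × ℝ) : 0 < M.linkGain a := by
  have hdist := hL.trans_le (le_dist3D L ‖a.1‖)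
  rcases M.linkGain_eq_or a with h | h <;> rw [h]
  exacts [M.gainLoS_pos hdist, M.gainNLoS_pos hdist]

lemma exists_linkGain_le (hL : 0 < L) : ∃ G, ∀ a, M.linkGain a ≤ G := by
  obtain ⟨G, hG⟩ := exists_piecewisePowerLaw_le M.d (fun n => (M.AL_pos n).le)
    (fun n => (M.αL_pos n).le) hL
  obtain ⟨G', hG'⟩ := exists_piecewisePowerLaw_le M.d (fun n => (M.ANL_pos n).le)
    (fun n => (M.αNL_pos n).le) hL
  refine ⟨max G G', fun a => ?_⟩
  rcases M.linkGain_eq_or a with h | h <;> rw [h]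
  exacts [le_max_of_le_left (hG _ (le_dist3D L _)), le_max_of_le_right (hG' _ (le_dist3D L _))]

lemma exists_linkGain_lt {ε : ℝ} (hε : 0 < ε) : ∃ R, ∀ a, R ≤ ‖a.1‖ → M.linkGain a < ε := by
  have hsmall : ∀ᶠ w in atTop, M.gainLoS w < ε ∧ M.gainNLoS w < ε :=
    ((tendsto_piecewisePowerLaw M.d M.αL_pos).eventually_lt_const hε).and
      ((tendsto_piecewisePowerLaw M.d M.αNL_pos).eventually_lt_const hε)
  obtain ⟨R, hR⟩ := eventually_atTop.1 hsmall
  refine ⟨R, fun a ha => ?_⟩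
  have hdist := hR _ (ha.trans (le_dist3D_self L ‖a.1‖))
  rcases M.linkGain_eq_or a with h | h <;> rw [h]
  exacts [hdist.1, hdist.2]

/-- The supremum of the path losses that occur with positive probability, that is, the path loss of
the serving link in the limit of a dense network. -/
def maxGain : ℝ := essSup M.linkGain linkMeasure

lemma linkGain_le_maxGain (hL : 0 < L) : ∀ᵐ a ∂linkMeasure, M.linkGain a ≤ M.maxGain := by
  obtain ⟨G, hG⟩ := M.exists_linkGain_le hL
  exact ae_le_essSup ⟨G, eventually_map.2 (ae_of_all _ hG)⟩

lemma maxGain_le (hL : 0 < L) {t : ℝ} (h : ∀ᵐ a ∂linkMeasure, M.linkGain a ≤ t) :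
    M.maxGain ≤ t :=
  limsup_le_of_le (IsBoundedUnder.isCoboundedUnder_le
    ⟨0, eventually_map.2 (ae_of_all _ fun a => (M.linkGain_pos hL a).le)⟩) h

lemma maxGain_pos (hL : 0 < L) : 0 < M.maxGain := by
  obtain ⟨a, ha⟩ := (M.linkGain_le_maxGain hL).exists
  exact (M.linkGain_pos hL a).trans_le ha

lemma measure_lt_linkGain_ne_zero_iff (hL : 0 < L) {t : ℝ} :
    linkMeasure {a | t < M.linkGain a} ≠ 0 ↔ t < M.maxGain := by
  refine ⟨fun h => ?_, fun ht h => ht.not_ge (M.maxGain_le hL ?_)⟩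
  · contrapose! h
    refine measure_eq_zero_iff_ae_notMem.2 ?_
    filter_upwards [M.linkGain_le_maxGain hL] with a ha using (ha.trans h).not_gt
  · filter_upwards [measure_eq_zero_iff_ae_notMem.1 h] with a ha using not_lt.1 ha

lemma eventually_lt_linkGain (hL : 0 < L) {w t : ℝ} (hw : L < w) (hw0 : pieceIndex M.d w = 0)
    (ht : t < M.pieceLoS 0 L) : ∀ᶠ x in 𝓝 (0 : Plane), ∀ u ≤ M.prL 0 w, t < M.linkGain (x, u) := by
  have hdist : Tendsto (fun x : Plane => dist3D L ‖x‖) (𝓝 0) (𝓝 L) :=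
    ((continuous_dist3D L).comp continuous_norm).tendsto' _ _ (by simp [dist3D_zero hL.le])
  have hcont : ContinuousAt (M.pieceLoS 0) L :=
    continuousAt_const.mul (Real.continuousAt_rpow_const _ _ (.inl hL.ne'))
  filter_upwards [hdist.eventually_lt_const hw, (hcont.tendsto.comp hdist).eventually_const_lt ht]
    with x hxw hxt u hu
  have hpiece : pieceIndex M.d (dist3D L ‖x‖) = 0 :=
    le_antisymm ((pieceIndex_mono M.d hxw.le).trans_eq hw0) (Fin.zero_le _)
  have hLoS : u ≤ M.probLoS (dist3D L ‖x‖) := by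
    rw [probLoS, hpiece]
    exact hu.trans (M.prL_antitone 0 ⟨le_dist3D L _, hpiece⟩ ⟨hw.le, hw0⟩ hxw.le)
  rwa [linkGain, if_pos hLoS, gainLoS, hpiece]

lemma pieceLoS_zero_le_maxGain (hL : 0 < L)
    (h : ∃ w, L < w ∧ pieceIndex M.d w = 0 ∧ 0 < M.prL 0 w) : M.pieceLoS 0 L ≤ M.maxGain := by
  obtain ⟨w, hw, hw0, hp⟩ := h
  refine le_of_forall_lt fun t ht => (M.measure_lt_linkGain_ne_zero_iff hL).1 ?_
  set s := {x : Plane | ∀ u ≤ M.prL 0 w, t < M.linkGain (x, u)}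
  have hsub : s ×ˢ Set.Iic (M.prL 0 w) ⊆ {a | t < M.linkGain a} := fun a ha => ha.1 a.2 ha.2
  have hpos : linkMeasure (s ×ˢ Set.Iic (M.prL 0 w)) ≠ 0 := by
    rw [Measure.prod_prod, unif_Iic (M.prL_mem 0 w hw.le hw0).2]
    exact mul_ne_zero
      (Measure.measure_pos_of_mem_nhds volume (M.eventually_lt_linkGain hL hw hw0 ht)).ne'
      (ENNReal.ofReal_pos.2 hp).ne'
  exact fun h => hpos (measure_mono_null hsub h)

lemma maxGain_eq_pieceLoS_zero (hL : 0 < L)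
    (hLoS : ∃ w, L < w ∧ pieceIndex M.d w = 0 ∧ 0 < M.prL 0 w)
    (hmax : ∀ w, L ≤ w → M.gainLoS w ≤ M.pieceLoS 0 L ∧ M.gainNLoS w ≤ M.pieceLoS 0 L) :
    M.maxGain = M.pieceLoS 0 L := by
  refine le_antisymm (M.maxGain_le hL (ae_of_all _ fun a => ?_))
    (M.pieceLoS_zero_le_maxGain hL hLoS)
  have hdist := hmax _ (le_dist3D L ‖a.1‖)
  rcases M.linkGain_eq_or a with h | h <;> rw [h]
  exacts [hdist.1, hdist.2]

end PathLoss

namespace PathLoss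

variable {m : ℕ} {L : ℝ} (M : PathLoss m L)

/-- Exponent per unit of density of the active base stations in the Laplace transform at `s` of the
total power received from them. -/
def interferenceExponent (P s : ℝ) : ℝ≥0∞ :=
  ∫⁻ a, ENNReal.ofReal (s * (P * M.linkGain a) / (1 + s * (P * M.linkGain a))) ∂linkMeasure

/-- Exponent of the Laplace transform at `s` of the noise power plus the total power received from
a Poisson process of active base stations of density `r`. -/
def laplaceExponent (P PN r s : ℝ) : ℝ≥0∞ :=
  ENNReal.ofReal (s * PN) + ENNReal.ofReal r * M.interferenceExponent P s

lemma interferenceExponent_mul_le (hL : 0 < L) {P s c : ℝ} (hP : 0 ≤ P) (hs : 0 ≤ s)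
    (hc : 1 ≤ c) :
    M.interferenceExponent P (c * s) ≤ ENNReal.ofReal c * M.interferenceExponent P s := by
  have hc0 : 0 ≤ c := zero_le_one.trans hc
  unfold interferenceExponent
  rw [← lintegral_const_mul _ (by fun_prop)]
  refine lintegral_mono fun a => ?_
  have hx : 0 ≤ s * (P * M.linkGain a) := by have := M.linkGain_pos hL a; positivity
  have hcx : s * (P * M.linkGain a) ≤ c * (s * (P * M.linkGain a)) := le_mul_of_one_le_left hx hc
  rw [← ENNReal.ofReal_mul hc0, mul_assoc c, ← mul_div_assoc]
  exact ENNReal.ofReal_le_ofReal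
    (div_le_div_of_nonneg_left (hx.trans hcx) (by positivity) (by linarith))

lemma laplaceExponent_mul_le (hL : 0 < L) {P s c : ℝ} (hP : 0 ≤ P) (hs : 0 ≤ s) (hc : 1 ≤ c)
    (PN r : ℝ) :
    M.laplaceExponent P PN r (c * s) ≤ ENNReal.ofReal c * M.laplaceExponent P PN r s := by
  rw [laplaceExponent, laplaceExponent, mul_add, mul_assoc,
    ENNReal.ofReal_mul (zero_le_one.trans hc), mul_left_comm]
  gcongr
  exact M.interferenceExponent_mul_le hL hP hs hc

lemma lintegral_comp_linkGain {f : ℝ → ℝ≥0∞} (hf : Measurable f) :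
    ∫⁻ a, f (M.linkGain a) ∂linkMeasure = ENNReal.ofReal (2 * Real.pi) *
      ∫⁻ r in Set.Ioi (0 : ℝ), ENNReal.ofReal r *
        (ENNReal.ofReal (M.probLoS (dist3D L r)) * f (M.gainLoS (dist3D L r)) +
          ENNReal.ofReal (1 - M.probLoS (dist3D L r)) * f (M.gainNLoS (dist3D L r))) := by
  have hpr := M.measurable_probLoS_dist3D
  have hLoS := hf.comp (M.measurable_gainLoS.comp (continuous_dist3D L).measurable)
  have hNLoS := hf.comp (M.measurable_gainNLoS.comp (continuous_dist3D L).measurable)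
  have hmark (x : Plane) : ∫⁻ u, f (M.linkGain (x, u)) ∂unif =
      ENNReal.ofReal (M.probLoS (dist3D L ‖x‖)) * f (M.gainLoS (dist3D L ‖x‖)) +
        ENNReal.ofReal (1 - M.probLoS (dist3D L ‖x‖)) * f (M.gainNLoS (dist3D L ‖x‖)) := by
    simp only [linkGain, apply_ite f]
    exact lintegral_ite_le_unif (M.probLoS_mem ‖x‖) _ _
  have hcomp : Measurable fun a => f (M.linkGain a) := hf.comp M.measurable_linkGain
  rw [lintegral_prod _ hcomp.aemeasurable]
  simp only [hmark]
  exact lintegral_norm_plane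
    ((hpr.ennreal_ofReal.mul hLoS).add ((measurable_const.sub hpr).ennreal_ofReal.mul hNLoS))

lemma interferenceExponent_eq (hL : 0 < L) {P s : ℝ} (hP : 0 < P) (hs : 0 < s) :
    M.interferenceExponent P s =
      ENNReal.ofReal (2 * Real.pi) * (M.integralLoS P s + M.integralNLoS P s) := by
  have hterm {r p z : ℝ} (hr : 0 < r) (hp : 0 ≤ p) (hz : 0 < z) :
      ENNReal.ofReal r * (ENNReal.ofReal p *
        ENNReal.ofReal (s * (P * z) / (1 + s * (P * z)))) =
      ENNReal.ofReal (p * r / (1 + (s * P * z)⁻¹)) := by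
    rw [← ENNReal.ofReal_mul hp, ← ENNReal.ofReal_mul hr.le]
    congr 1
    field_simp
    ring
  have hmeas : Measurable fun r => ENNReal.ofReal
      (M.probLoS (dist3D L r) * r / (1 + (s * P * M.gainLoS (dist3D L r))⁻¹)) := by
    have := M.measurable_probLoS_dist3D
    have := M.measurable_gainLoS.comp (continuous_dist3D L).measurable
    fun_prop
  rw [interferenceExponent, M.lintegral_comp_linkGain
    (f := fun z => ENNReal.ofReal (s * (P * z) / (1 + s * (P * z)))) (by fun_prop),
    integralLoS, integralNLoS, ← lintegral_add_left hmeas]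
  congr 1
  refine setLIntegral_congr_fun measurableSet_Ioi fun r hr => ?_
  have hdist := hL.trans_le (le_dist3D L r)
  have hp := M.probLoS_mem r
  rw [mul_add, hterm hr hp.1 (M.gainLoS_pos hdist),
    hterm hr (sub_nonneg.2 hp.2) (M.gainNLoS_pos hdist)]

lemma coverageLimit_eq (hL : 0 < L) {P PN ρ γ : ℝ} (hP : 0 < P) (hPN : 0 ≤ PN) (hρ : 0 ≤ ρ)
    (hγ : 0 < γ) :
    M.coverageLimit P PN ρ γ =
      expNeg (M.laplaceExponent P PN ρ (γ / (P * M.pieceLoS 0 L))) := by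
  have hz : 0 < M.pieceLoS 0 L := mul_pos (M.AL_pos 0) (Real.rpow_pos_of_pos hL _)
  have hs : 0 < γ / (P * M.pieceLoS 0 L) := by positivity
  change ENNReal.ofReal _ * (expNeg _ * expNeg _) = _
  rw [laplaceExponent, expNeg_add, expNeg_ofReal (by positivity), ← expNeg_add, ← mul_add,
    M.interferenceExponent_eq hL hP hs, ← mul_assoc, ← ENNReal.ofReal_mul hρ, mul_comm ρ,
    mul_comm PN, div_mul_eq_mul_div]

end PathLoss

section StrongestIndex

lemma measurable_nat_sInf {α : Type*} [MeasurableSpace α] {s : α → Set ℕ}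
    (hs : ∀ i, MeasurableSet {a | i ∈ s a}) : Measurable fun a => sInf (s a) := by
  refine measurable_of_Iic fun n => ?_
  have hpre : (fun a => sInf (s a)) ⁻¹' Set.Iic n =
      (⋃ i ≤ n, {a | i ∈ s a}) ∪ ⋂ i, {a | i ∈ s a}ᶜ := by
    ext a
    simp only [Set.mem_preimage, Set.mem_Iic, Set.mem_union, Set.mem_iUnion, Set.mem_iInter,
      Set.mem_compl_iff, Set.mem_ofPred_eq, exists_prop]
    constructor
    · intro h
      rcases (s a).eq_empty_or_nonempty with hempty | hne
      · exact .inr fun i => hempty ▸ Set.notMem_empty i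
      · exact .inl ⟨_, h, Nat.sInf_mem hne⟩
    · rintro (⟨i, hi, his⟩ | hempty)
      · exact (Nat.sInf_le his).trans hi
      · simp [Set.eq_empty_of_forall_notMem hempty]
  rw [hpre]
  exact (MeasurableSet.biUnion (Set.to_countable _) fun i _ => hs i).union
    (MeasurableSet.iInter fun i => (hs i).compl)

/-- The first index at which the sequence `z` attains its maximum, and `0` if there is none: the
serving base station if `z i` is the path loss of the `i`-th link. -/
def firstMaxIndex (z : ℕ → ℝ) : ℕ := sInf {i | ∀ j, z j ≤ z i}

@[fun_prop] lemma measurable_firstMaxIndex : Measurable firstMaxIndex := by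
  refine measurable_nat_sInf fun i => ?_
  simp only [Set.mem_ofPred_eq]
  measurability

lemma le_firstMaxIndex {z : ℕ → ℝ} (hz : ∃ i, {j | z i ≤ z j}.Finite) (j : ℕ) :
    z j ≤ z (firstMaxIndex z) := by
  obtain ⟨i, hi⟩ := hz
  obtain ⟨k, hik, hk⟩ := Set.exists_max_image _ z hi ⟨i, le_refl (z i)⟩
  have hmax : ∀ j, z j ≤ z k := fun j => (le_or_gt (z i) (z j)).elim (hk j) fun h => h.le.trans hik
  exact Nat.sInf_mem (s := {i | ∀ j, z j ≤ z i}) ⟨k, hmax⟩ j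

lemma measurable_apply_nat {α : Type*} [MeasurableSpace α] :
    Measurable fun x : ℕ × (ℕ → α) => x.2 x.1 :=
  measurable_from_prod_countable_right fun i => measurable_pi_apply i

end StrongestIndex

section ReceivedPower

variable {P p : ℝ} {z : ℕ → ℝ} {w : ℕ → ℝ × ℝ}

/-- Power received from all active base stations, where the `i`-th link has path loss `z i` and
`w i` consists of its activity mark and its fading gain. -/
def totalPower (P p : ℝ) (z : ℕ → ℝ) (w : ℕ → ℝ × ℝ) : ℝ≥0∞ :=
  ∑' i, activePower p (P * z i) (w i)

/-- Power received from all active base stations except the `k`-th one, with the conventions of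
`totalPower`. -/
def powerExcept (P p : ℝ) (k : ℕ) (z : ℕ → ℝ) (w : ℕ → ℝ × ℝ) : ℝ≥0∞ :=
  ∑' i, if i = k then 0 else activePower p (P * z i) (w i)

lemma totalPower_eq_add_powerExcept (k : ℕ) :
    totalPower P p z w = activePower p (P * z k) (w k) + powerExcept P p k z w := by
  rw [totalPower, ENNReal.tsum_eq_add_tsum_ite k, powerExcept]
  congr!

lemma powerExcept_le_totalPower (k : ℕ) : powerExcept P p k z w ≤ totalPower P p z w :=
  le_add_self.trans_eq (totalPower_eq_add_powerExcept k).symm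

lemma powerExcept_update (k : ℕ) (a : ℝ × ℝ) :
    powerExcept P p k z (Function.update w k a) = powerExcept P p k z w := by
  refine tsum_congr fun i => ?_
  split_ifs with h
  · rfl
  · rw [Function.update_of_ne h]

lemma measurable_activePower_apply (P p : ℝ) (i : ℕ) :
    Measurable fun x : (ℕ → ℝ) × (ℕ → ℝ × ℝ) => activePower p (P * x.1 i) (x.2 i) :=
  (measurable_activePower p).comp
    (f := fun x : (ℕ → ℝ) × (ℕ → ℝ × ℝ) => (P * x.1 i, x.2 i)) (by fun_prop)

lemma measurable_totalPower (P p : ℝ) : Measurable (totalPower P p).uncurry :=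
  Measurable.tsum fun i => measurable_activePower_apply P p i

lemma measurable_powerExcept_firstMaxIndex (P p : ℝ) :
    Measurable fun x : (ℕ → ℝ) × (ℕ → ℝ × ℝ) => powerExcept P p (firstMaxIndex x.1) x.1 x.2 := by
  have h : Measurable fun x : ℕ × ((ℕ → ℝ) × (ℕ → ℝ × ℝ)) => powerExcept P p x.1 x.2.1 x.2.2 :=
    measurable_from_prod_countable_right fun k => Measurable.tsum fun i => by
      dsimp only
      split_ifs
      exacts [measurable_const, measurable_activePower_apply P p i]
  exact h.comp ((measurable_firstMaxIndex.comp measurable_fst).prodMk measurable_id)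

/-- The path losses `x.1` together with the activity marks and fading gains `x.2` for which the
signal-to-interference-plus-noise ratio of the strongest link exceeds `γ`. -/
def coveredLinks (P PN p γ : ℝ) : Set ((ℕ → ℝ) × (ℕ → ℝ × ℝ)) :=
  {x | ENNReal.ofReal γ <
    ENNReal.ofReal (P * x.1 (firstMaxIndex x.1) * (x.2 (firstMaxIndex x.1)).2) /
      (powerExcept P p (firstMaxIndex x.1) x.1 x.2 + ENNReal.ofReal PN)}

lemma measurableSet_coveredLinks (P PN p γ : ℝ) : MeasurableSet (coveredLinks P PN p γ) := by
  have hK : Measurable fun x : (ℕ → ℝ) × (ℕ → ℝ × ℝ) => firstMaxIndex x.1 := by fun_prop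
  have hz := measurable_apply_nat.comp (hK.prodMk measurable_fst)
  have hw := measurable_apply_nat.comp (hK.prodMk measurable_snd)
  exact measurableSet_lt measurable_const (((hz.const_mul P).mul hw.snd).ennreal_ofReal.div
    ((measurable_powerExcept_firstMaxIndex P p).add_const _))

end ReceivedPower

namespace Deployment

variable {Ω : Type*} {D : Deployment Ω} {lam : ℝ} {m : ℕ} {L : ℝ} {M : PathLoss m L}

lemma interference_eq_powerExcept {P q ρ : ℝ} {ω : Ω} :
    D.interference M P q ρ lam ω = powerExcept P (activeDensity q ρ lam / lam) (D.serving M ω)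
      (fun i => D.gain M i ω) (fun i => (D.V i ω, D.g i ω)) := by
  refine tsum_congr fun i => ?_
  rw [ite_and, ite_not]
  rfl

variable (M) in
/-- Total power received from all active base stations, the serving one included if it is
active. -/
def receivedPower (D : Deployment Ω) (P q ρ lam : ℝ) (ω : Ω) : ℝ≥0∞ :=
  totalPower P (activeDensity q ρ lam / lam) (fun i => D.gain M i ω) fun i => (D.V i ω, D.g i ω)

lemma interference_le_receivedPower {P q ρ : ℝ} {ω : Ω} :
    D.interference M P q ρ lam ω ≤ D.receivedPower M P q ρ lam ω :=
  interference_eq_powerExcept.trans_le (powerExcept_le_totalPower _)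

lemma gain_pos (hL : 0 < L) (i : ℕ) (ω : Ω) : 0 < D.gain M i ω :=
  M.linkGain_pos hL (D.X i ω, D.U i ω)

namespace IsNetwork

variable [MeasurableSpace Ω] {μ : Measure Ω}

lemma measurable_gain (hD : D.IsNetwork lam μ) (i : ℕ) : Measurable (D.gain M i) :=
  M.measurable_linkGain.comp ((hD.poisson.measurable i).prodMk (hD.measurable_U i))

lemma measurable_fading (hD : D.IsNetwork lam μ) (i : ℕ) :
    Measurable fun ω => (D.V i ω, D.g i ω) :=
  (hD.measurable_V i).prodMk (hD.measurable_g i)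

lemma measurable_links (hD : D.IsNetwork lam μ) :
    Measurable fun ω => (fun i => D.gain M i ω, fun i => (D.V i ω, D.g i ω)) :=
  (measurable_pi_lambda _ hD.measurable_gain).prodMk (measurable_pi_lambda _ hD.measurable_fading)

lemma ae_finite_norm_le (hD : D.IsNetwork lam μ) :
    ∀ᵐ ω ∂μ, ∀ R : ℝ, {i | ‖D.X i ω‖ ≤ R}.Finite := by
  have hball (n : ℕ) : ∀ᵐ ω ∂μ, {i | ‖D.X i ω‖ ≤ n}.Finite := by
    filter_upwards [hD.poisson.ae_pointCount_lt_top (B := Metric.closedBall (0 : Plane) n)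
      measurableSet_closedBall (ENNReal.mul_ne_top ENNReal.ofReal_ne_top
        measure_closedBall_lt_top.ne)] with ω hω
    simpa [pointCount] using Set.encard_lt_top_iff.1 hω
  filter_upwards [ae_all_iff.2 hball] with ω hω R
  obtain ⟨n, hn⟩ := exists_nat_ge R
  exact (hω n).subset fun i hi => hi.trans hn

lemma ae_gain_le_serving (hD : D.IsNetwork lam μ) (hL : 0 < L) :
    ∀ᵐ ω ∂μ, ∀ i, D.gain M i ω ≤ D.gain M (D.serving M ω) ω := by
  filter_upwards [hD.ae_finite_norm_le] with ω hω
  obtain ⟨R, hR⟩ := M.exists_linkGain_lt (gain_pos (D := D) (M := M) hL 0 ω)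
  refine le_firstMaxIndex (z := fun i => D.gain M i ω) ⟨0, (hω R).subset fun i hi => ?_⟩
  by_contra hfar
  exact (hR (D.X i ω, D.U i ω) (not_le.1 hfar).le).not_ge hi

lemma measurableSet_forall_notMem (hD : D.IsNetwork lam μ) {A : Set (Plane × ℝ)}
    (hA : MeasurableSet A) : MeasurableSet {ω | ∀ i, (D.X i ω, D.U i ω) ∉ A} := by
  rw [Set.ofPred_forall]
  exact MeasurableSet.iInter fun i =>
    (((hD.poisson.measurable i).prodMk (hD.measurable_U i)) hA).compl

lemma map_mark (hD : D.IsNetwork lam μ) (i : ℕ) :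
    μ.map (fun ω => (D.U i ω, D.V i ω, D.g i ω)) = unif.prod fadingLaw := hD.mark_law i

lemma map_fading (hD : D.IsNetwork lam μ) (i : ℕ) :
    μ.map (fun ω => (D.V i ω, D.g i ω)) = fadingLaw := by
  have h := congrArg (Measure.map Prod.snd) (hD.map_mark i)
  rwa [Measure.map_map measurable_snd ((hD.measurable_U i).prodMk (hD.measurable_fading i)),
    Measure.map_snd_prod, measure_univ, one_smul] at h

variable [IsProbabilityMeasure μ]

lemma indepFun_gain_fading (hD : D.IsNetwork lam μ) :
    IndepFun (fun ω i => D.gain M i ω) (fun ω i => (D.V i ω, D.g i ω)) μ := by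
  have hU (i : ℕ) : IndepFun (D.U i) (fun ω => (D.V i ω, D.g i ω)) μ := by
    rw [indepFun_iff_map_prod_eq_prod_map_map (hD.measurable_U i).aemeasurable
      (hD.measurable_fading i).aemeasurable, hD.map_fading, hD.map_mark]
    have h := congrArg (Measure.map Prod.fst) (hD.map_mark i)
    rw [Measure.map_map measurable_fst ((hD.measurable_U i).prodMk (hD.measurable_fading i)),
      Measure.map_fst_prod, measure_univ, one_smul] at h
    exact congrArg (fun κ => κ.prod fadingLaw) h.symm
  have hmarks := indepFun_pi_of_iIndepFun_prodMk hD.measurable_U hD.measurable_fading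
    hD.mark_iIndep hU
  have hpositions : IndepFun (fun ω i => D.X i ω)
      (fun ω => (fun i => D.U i ω, fun i => (D.V i ω, D.g i ω))) μ :=
    hD.mark_indep.comp measurable_id
      (ψ := fun y : ℕ → ℝ × ℝ × ℝ => (fun i => (y i).1, fun i => (y i).2)) (by fun_prop)
  have hlinks := indepFun_prodMk_left_of_prodMk_right
    (measurable_pi_lambda _ hD.poisson.measurable) (measurable_pi_lambda _ hD.measurable_U)
    (measurable_pi_lambda _ hD.measurable_fading) hpositions hmarks
  exact hlinks.comp (φ := fun y : (ℕ → Plane) × (ℕ → ℝ) => fun i => M.linkGain (y.1 i, y.2 i))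
    (by fun_prop) measurable_id

lemma lintegral_resample_serving (hD : D.IsNetwork lam μ)
    {f : (ℕ → ℝ) → (ℕ → ℝ × ℝ) → ℝ≥0∞} (hf : Measurable f.uncurry) :
    ∫⁻ ω, f (fun i => D.gain M i ω) (fun i => (D.V i ω, D.g i ω)) ∂μ =
      ∫⁻ ω, ∫⁻ a, f (fun i => D.gain M i ω)
        (Function.update (fun i => (D.V i ω, D.g i ω)) (D.serving M ω) a) ∂fadingLaw ∂μ :=
  lintegral_update_of_indepFun (measurable_pi_lambda _ hD.measurable_gain) hD.measurable_fading
    measurable_firstMaxIndex hf hD.indepFun_gain_fading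
    (hD.mark_iIndep.comp (fun _ => Prod.snd) fun _ => measurable_snd) hD.map_fading

lemma coverage_eq_lintegral (hD : D.IsNetwork lam μ) (hL : 0 < L) {P γ : ℝ} (hP : 0 < P)
    (hγ : 0 < γ) (PN q ρ : ℝ) :
    D.coverage M μ P PN q ρ γ lam =
      ∫⁻ ω, expNeg (ENNReal.ofReal (γ / (P * D.gain M (D.serving M ω) ω)) *
        (D.interference M P q ρ lam ω + ENNReal.ofReal PN)) ∂μ := by
  set S := coveredLinks P PN (activeDensity q ρ lam / lam) γ
  have hS : MeasurableSet S := measurableSet_coveredLinks _ _ _ _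
  have hcov : D.coverage M μ P PN q ρ γ lam =
      μ ((fun ω => (fun i => D.gain M i ω, fun i => (D.V i ω, D.g i ω))) ⁻¹' S) := by
    simp only [coverage, sinr, interference_eq_powerExcept]
    rfl
  rw [hcov, ← lintegral_indicator_one (hD.measurable_links hS)]
  refine (hD.lintegral_resample_serving (f := fun z w => S.indicator 1 (z, w))
    (measurable_one.indicator hS)).trans (lintegral_congr fun ω => ?_)
  have hpower : 0 < P * D.gain M (D.serving M ω) ω := mul_pos hP (gain_pos hL _ _)
  have hmeas : MeasurableSet {w : ℝ × ℝ | ENNReal.ofReal γ <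
      ENNReal.ofReal (P * D.gain M (D.serving M ω) ω * w.2) /
        (D.interference M P q ρ lam ω + ENNReal.ofReal PN)} :=
    measurableSet_lt measurable_const (by fun_prop)
  rw [← fadingLaw_lt_mul_snd_div hγ hpower, ← lintegral_indicator_one hmeas]
  refine lintegral_congr fun a => ?_
  have hindex : firstMaxIndex (fun i => D.gain M i ω) = D.serving M ω := rfl
  simp only [S, coveredLinks, Set.indicator, Set.mem_ofPred_eq, hindex, powerExcept_update,
    Function.update_self, interference_eq_powerExcept, Pi.one_apply]

lemma lintegral_expNeg_receivedPower_eq_lintegral_interference (hD : D.IsNetwork lam μ)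
    (hL : 0 < L) {P q ρ s : ℝ} (hP : 0 ≤ P)
    (hp : activeDensity q ρ lam / lam ∈ Set.Icc (0 : ℝ) 1) (hs : 0 ≤ s) (b : ℝ≥0∞) :
    ∫⁻ ω, expNeg (ENNReal.ofReal s * (D.receivedPower M P q ρ lam ω + b)) ∂μ =
      ∫⁻ ω, ENNReal.ofReal (1 - activeDensity q ρ lam / lam *
          (s * (P * D.gain M (D.serving M ω) ω) / (1 + s * (P * D.gain M (D.serving M ω) ω)))) *
        expNeg (ENNReal.ofReal s * (D.interference M P q ρ lam ω + b)) ∂μ := by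
  set p := activeDensity q ρ lam / lam
  have hmeas : Measurable (Function.uncurry fun z w =>
      expNeg (ENNReal.ofReal s * (totalPower P p z w + b))) :=
    measurable_expNeg.comp (((measurable_totalPower P p).add_const b).const_mul _)
  refine (hD.lintegral_resample_serving hmeas).trans (lintegral_congr fun ω => ?_)
  have hpower : 0 ≤ P * D.gain M (D.serving M ω) ω := mul_nonneg hP (gain_pos hL _ _).le
  rw [← lintegral_expNeg_activePower hp hs hpower, ← lintegral_mul_const _ (by fun_prop)]
  refine lintegral_congr fun a => ?_
  rw [totalPower_eq_add_powerExcept (D.serving M ω), powerExcept_update, Function.update_self,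
    ← interference_eq_powerExcept, add_assoc, mul_add, expNeg_add]

lemma lintegral_expNeg_tsum_link (hD : D.IsNetwork lam μ) {F : (Plane × ℝ) × (ℝ × ℝ) → ℝ≥0∞}
    (hF : Measurable F) :
    ∫⁻ ω, expNeg (∑' i, F ((D.X i ω, D.U i ω), (D.V i ω, D.g i ω))) ∂μ =
      expNeg (ENNReal.ofReal lam *
        ∫⁻ a, (1 - ∫⁻ w, expNeg (F (a, w)) ∂fadingLaw) ∂linkMeasure) := by
  have : SigmaFinite (ENNReal.ofReal lam • (volume : Measure Plane)) :=
    inferInstanceAs (SigmaFinite (lam.toNNReal • (volume : Measure Plane)))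
  have hassoc : Measurable fun y : Plane × ℝ × (ℝ × ℝ) => F ((y.1, y.2.1), y.2.2) :=
    hF.comp (by fun_prop)
  rw [hD.poisson.lintegral_expNeg_tsum_marked
    (fun i => (hD.measurable_U i).prodMk (hD.measurable_fading i)) hD.mark_indep hD.mark_iIndep
    hD.map_mark hassoc, Measure.prod_smul_left, lintegral_smul_measure, smul_eq_mul,
    ← Measure.prodAssoc_prod, lintegral_map (by fun_prop) (by fun_prop),
    lintegral_prod _ (by fun_prop)]
  exact congrArg (fun x => expNeg (ENNReal.ofReal lam * x)) <| lintegral_congr fun a =>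
    lintegral_one_sub_expNeg (f := fun w => F (a, w)) (by fun_prop)

lemma lintegral_expNeg_receivedPower (hD : D.IsNetwork lam μ) (hL : 0 < L) (hlam : 0 < lam)
    {P PN q ρ s : ℝ} (hP : 0 ≤ P) (hp : activeDensity q ρ lam / lam ∈ Set.Icc (0 : ℝ) 1)
    (hs : 0 ≤ s) :
    ∫⁻ ω, expNeg (ENNReal.ofReal s * (D.receivedPower M P q ρ lam ω + ENNReal.ofReal PN)) ∂μ =
      expNeg (M.laplaceExponent P PN (activeDensity q ρ lam) s) := by
  set p := activeDensity q ρ lam / lam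
  have hF : Measurable fun y : (Plane × ℝ) × (ℝ × ℝ) =>
      ENNReal.ofReal s * activePower p (P * M.linkGain y.1) y.2 :=
    ((measurable_activePower p).comp (f := fun y : (Plane × ℝ) × (ℝ × ℝ) =>
      (P * M.linkGain y.1, y.2)) (by fun_prop)).const_mul _
  have hlink (a : Plane × ℝ) :
      1 - ∫⁻ w, expNeg (ENNReal.ofReal s * activePower p (P * M.linkGain a) w) ∂fadingLaw =
        ENNReal.ofReal p *
          ENNReal.ofReal (s * (P * M.linkGain a) / (1 + s * (P * M.linkGain a))) := by
    have hx : 0 ≤ P * M.linkGain a := mul_nonneg hP (M.linkGain_pos hL a).le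
    have hratio : s * (P * M.linkGain a) / (1 + s * (P * M.linkGain a)) ≤ 1 :=
      div_le_one_of_le₀ (by linarith) (by positivity)
    rw [lintegral_expNeg_activePower hp hs hx, ← ENNReal.ofReal_one, ← ENNReal.ofReal_sub _
      (sub_nonneg.2 (mul_le_one₀ hp.2 (by positivity) hratio)), sub_sub_cancel,
      ENNReal.ofReal_mul hp.1]
  have hLaplace := hD.lintegral_expNeg_tsum_link hF
  simp only [hlink] at hLaplace
  rw [lintegral_const_mul _ (by fun_prop), ← mul_assoc, ← ENNReal.ofReal_mul hlam.le,
    mul_div_cancel₀ _ hlam.ne'] at hLaplace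
  have hsplit (ω : Ω) :
      expNeg (ENNReal.ofReal s * (D.receivedPower M P q ρ lam ω + ENNReal.ofReal PN)) =
        expNeg (ENNReal.ofReal (s * PN)) * expNeg (∑' i, ENNReal.ofReal s *
          activePower p (P * M.linkGain (D.X i ω, D.U i ω)) (D.V i ω, D.g i ω)) := by
    rw [add_comm, mul_add, expNeg_add, ← ENNReal.ofReal_mul hs, ENNReal.tsum_mul_left]
    rfl
  simp only [hsplit]
  rw [lintegral_const_mul' _ _ (ne_top_of_le_ne_top ENNReal.one_ne_top (expNeg_le_one _)), hLaplace,
    ← expNeg_add]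
  rfl

lemma measure_forall_notMem (hD : D.IsNetwork lam μ) {A : Set (Plane × ℝ)}
    (hA : MeasurableSet A) :
    μ {ω | ∀ i, (D.X i ω, D.U i ω) ∉ A} = expNeg (ENNReal.ofReal lam * linkMeasure A) := by
  have hLaplace := hD.lintegral_expNeg_tsum_link (F := fun y => A.indicator (fun _ => ∞) y.1)
    ((measurable_const.indicator hA).comp measurable_fst)
  have hsum (ω : Ω) : expNeg (∑' i, A.indicator (fun _ => ∞) (D.X i ω, D.U i ω)) =
      {ω | ∀ i, (D.X i ω, D.U i ω) ∉ A}.indicator 1 ω := by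
    by_cases h : ∀ i, (D.X i ω, D.U i ω) ∉ A
    · simp [h]
    · obtain ⟨i, hi⟩ := not_forall_not.1 h
      rw [ENNReal.tsum_eq_top_of_eq_top ⟨i, Set.indicator_of_mem hi _⟩, expNeg_top,
        Set.indicator_of_notMem (s := {ω | ∀ i, (D.X i ω, D.U i ω) ∉ A}) h]
  have hlink (a : Plane × ℝ) : 1 - ∫⁻ _w, expNeg (A.indicator (fun _ => ∞) a) ∂fadingLaw =
      A.indicator 1 a := by
    by_cases h : a ∈ A <;> simp [h]
  simp only [hsum, hlink] at hLaplace
  rwa [lintegral_indicator_one (hD.measurableSet_forall_notMem hA),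
    lintegral_indicator_one hA] at hLaplace

lemma ae_gain_le_maxGain (hD : D.IsNetwork lam μ) (hL : 0 < L) :
    ∀ᵐ ω ∂μ, ∀ i, D.gain M i ω ≤ M.maxGain := by
  have hA : MeasurableSet {a | M.maxGain < M.linkGain a} :=
    measurableSet_lt measurable_const M.measurable_linkGain
  have hnull : linkMeasure {a | M.maxGain < M.linkGain a} = 0 :=
    not_ne_iff.1 fun h => lt_irrefl _ ((M.measure_lt_linkGain_ne_zero_iff hL).1 h)
  have hvoid := hD.measure_forall_notMem hA
  rw [hnull, mul_zero, expNeg_zero,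
    ← mem_ae_iff_prob_eq_one (hD.measurableSet_forall_notMem hA)] at hvoid
  filter_upwards [hvoid] with ω hω i using not_lt.1 (hω i)

lemma coverage_le (hD : D.IsNetwork lam μ) (hL : 0 < L) (hlam : 0 < lam) {P PN q ρ γ : ℝ}
    (hP : 0 < P) (hγ : 0 < γ) (hp : activeDensity q ρ lam / lam ∈ Set.Icc (0 : ℝ) 1) :
    ENNReal.ofReal (1 - activeDensity q ρ lam / lam * (γ / (1 + γ))) *
        D.coverage M μ P PN q ρ γ lam ≤
      expNeg (M.laplaceExponent P PN (activeDensity q ρ lam) (γ / (P * M.maxGain))) := by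
  have hZ := M.maxGain_pos hL
  have hs : 0 ≤ γ / (P * M.maxGain) := by positivity
  rw [hD.coverage_eq_lintegral hL hP hγ, ← lintegral_const_mul' _ _ ENNReal.ofReal_ne_top,
    ← hD.lintegral_expNeg_receivedPower hL hlam hP.le hp hs,
    hD.lintegral_expNeg_receivedPower_eq_lintegral_interference hL hP.le hp hs]
  refine lintegral_mono_ae ?_
  filter_upwards [hD.ae_gain_le_maxGain (M := M) hL] with ω hω
  have hz := gain_pos (D := D) (M := M) hL (D.serving M ω) ω
  have hzZ := hω (D.serving M ω)
  have hpower : γ / (P * M.maxGain) * (P * D.gain M (D.serving M ω) ω) ≤ γ := by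
    rw [div_mul_eq_mul_div, div_le_iff₀ (by positivity)]
    gcongr
  refine mul_le_mul' (ENNReal.ofReal_le_ofReal ?_) (expNeg_antitone ?_)
  · have hp0 := hp.1
    gcongr 1 - _ * ?_
    rw [div_le_div_iff₀ (by positivity) (by positivity)]
    nlinarith
  · gcongr

lemma expNeg_laplaceExponent_le (hD : D.IsNetwork lam μ) (hL : 0 < L) (hlam : 0 < lam)
    {P PN q ρ γ t : ℝ} (hP : 0 < P) (hγ : 0 < γ) (ht : 0 < t)
    (hp : activeDensity q ρ lam / lam ∈ Set.Icc (0 : ℝ) 1) :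
    expNeg (M.laplaceExponent P PN (activeDensity q ρ lam) (γ / (P * t))) ≤
      D.coverage M μ P PN q ρ γ lam +
        expNeg (ENNReal.ofReal lam * linkMeasure {a | t < M.linkGain a}) := by
  have hA : MeasurableSet {a | t < M.linkGain a} :=
    measurableSet_lt measurable_const M.measurable_linkGain
  have hvoid := hD.measurableSet_forall_notMem hA
  rw [hD.coverage_eq_lintegral hL hP hγ, ← hD.measure_forall_notMem hA,
    ← hD.lintegral_expNeg_receivedPower hL hlam hP.le hp (by positivity),
    ← lintegral_indicator_one hvoid, ← lintegral_add_right _ (measurable_one.indicator hvoid)]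
  refine lintegral_mono_ae ?_
  filter_upwards [hD.ae_gain_le_serving (M := M) hL] with ω hω
  by_cases h : ω ∈ {ω | ∀ i, (D.X i ω, D.U i ω) ∉ {a | t < M.linkGain a}}
  · exact ((expNeg_le_one _).trans_eq (Set.indicator_of_mem h 1).symm).trans le_add_self
  · obtain ⟨i, hi⟩ := not_forall_not.1 h
    have hserving : t ≤ D.gain M (D.serving M ω) ω := (le_of_lt hi).trans (hω i)
    refine (expNeg_antitone ?_).trans le_self_add
    gcongr
    exact interference_le_receivedPower

end IsNetwork

end Deployment

lemma activeDensity_div_mem_Icc {q ρ lam : ℝ} (hq : 0 ≤ q) (hρ : 0 ≤ ρ) (hlam : 0 < lam) :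
    activeDensity q ρ lam / lam ∈ Set.Icc (0 : ℝ) 1 := by
  have hbase : 1 ≤ 1 + ρ / (q * lam) := le_add_of_nonneg_right (by positivity)
  have hpow : 1 ≤ (1 + ρ / (q * lam)) ^ q := Real.one_le_rpow hbase hq
  rw [activeDensity, mul_div_cancel_left₀ _ hlam.ne']
  exact ⟨sub_nonneg.2 (div_le_one_of_le₀ hpow (by positivity)), sub_le_self _ (by positivity)⟩

/- Up to the substitution `y = 1 / lam`, the active density is a difference quotient at `0` of
`y ↦ -(1 + ρ / q * y) ^ (-q)`. -/
lemma tendsto_activeDensity {q ρ : ℝ} (hq : 0 < q) (hρ : 0 ≤ ρ) :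
    Tendsto (activeDensity q ρ) atTop (𝓝 ρ) := by
  have hbase : HasDerivAt (fun y : ℝ => 1 + ρ / q * y) (ρ / q) 0 := by
    simpa using ((hasDerivAt_id (0 : ℝ)).const_mul (ρ / q)).const_add 1
  have hderiv : HasDerivAt (fun y : ℝ => -(1 + ρ / q * y) ^ (-q)) ρ 0 :=
    (hbase.rpow_const (p := -q) (.inl (by simp))).neg.congr_deriv (by simp; field_simp)
  refine (hderiv.tendsto_slope_zero_right.comp tendsto_inv_atTop_nhdsGT_zero).congr' ?_
  filter_upwards [eventually_gt_atTop 0] with lam hlam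
  simp only [Function.comp_apply, smul_eq_mul, zero_add, mul_zero, add_zero, Real.one_rpow, inv_inv]
  rw [activeDensity, one_div, ← Real.rpow_neg (by positivity), ← div_eq_mul_inv, div_div]
  ring

lemma tendsto_expNeg_mul_atTop {x : ℝ≥0∞} (hx : x ≠ 0) :
    Tendsto (fun lam : ℝ => expNeg (ENNReal.ofReal lam * x)) atTop (𝓝 0) := by
  have hmul := ENNReal.Tendsto.mul_const (b := x) ENNReal.tendsto_ofReal_atTop
    (.inl ENNReal.top_ne_zero)
  rw [ENNReal.top_mul hx] at hmul
  rw [← expNeg_top]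
  exact (continuous_expNeg.tendsto ∞).comp hmul

namespace PathLoss

variable {m : ℕ} {L : ℝ} (M : PathLoss m L)

lemma tendsto_expNeg_laplaceExponent {P PN ρ s : ℝ} (hρ : 0 < ρ) {ι : Type*} {l : Filter ι}
    {r : ι → ℝ} (hr : Tendsto r l (𝓝 ρ)) :
    Tendsto (fun i => expNeg (M.laplaceExponent P PN (r i) s)) l
      (𝓝 (expNeg (M.laplaceExponent P PN ρ s))) :=
  (continuous_expNeg.tendsto _).comp <| tendsto_const_nhds.add <|
    ENNReal.Tendsto.mul_const (ENNReal.tendsto_ofReal hr) (.inl (ENNReal.ofReal_pos.2 hρ).ne')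

lemma exists_lt_expNeg_laplaceExponent (hL : 0 < L) {P PN ρ γ z : ℝ} (hP : 0 < P) (hγ : 0 ≤ γ)
    (hz : 0 < z) {b : ℝ≥0∞} (hb : b < expNeg (M.laplaceExponent P PN ρ (γ / (P * z)))) :
    ∃ t, 0 < t ∧ t < z ∧ b < expNeg (M.laplaceExponent P PN ρ (γ / (P * t))) := by
  set E := M.laplaceExponent P PN ρ (γ / (P * z))
  have hratio : Tendsto (fun t => ENNReal.ofReal (z / t)) (𝓝[<] z) (𝓝 1) := by
    have hdiv : Tendsto (fun t => z / t) (𝓝[<] z) (𝓝 (z / z)) :=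
      (tendsto_const_nhds.div tendsto_id hz.ne').mono_left nhdsWithin_le_nhds
    simpa only [div_self hz.ne', ENNReal.ofReal_one] using ENNReal.tendsto_ofReal hdiv
  have hbound : Tendsto (fun t => expNeg (ENNReal.ofReal (z / t) * E)) (𝓝[<] z)
      (𝓝 (expNeg E)) := by
    have hmul := ENNReal.Tendsto.mul_const (b := E) hratio (.inl one_ne_zero)
    rw [one_mul] at hmul
    exact (continuous_expNeg.tendsto _).comp hmul
  obtain ⟨t, hbt, htz, ht⟩ := ((hbound.eventually (lt_mem_nhds hb)).and
    (eventually_mem_nhdsWithin.and (nhdsWithin_le_nhds (lt_mem_nhds hz)))).exists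
  refine ⟨t, ht, htz, hbt.trans_le (expNeg_antitone ?_)⟩
  have hscale : γ / (P * t) = z / t * (γ / (P * z)) := by field_simp
  rw [hscale]
  exact M.laplaceExponent_mul_le hL hP.le (by positivity)
    ((one_le_div ht).2 (le_of_lt htz)) PN ρ

end PathLoss

section Limit

variable {m : ℕ} {L : ℝ} {M : PathLoss m L} {P PN ρ γ q : ℝ} {Ω : ℝ → Type*}
  [∀ lam, MeasurableSpace (Ω lam)] {μ : ∀ lam, Measure (Ω lam)}
  [∀ lam, IsProbabilityMeasure (μ lam)] {D : ∀ lam, Deployment (Ω lam)}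

lemma eventually_lt_coverage (hD : ∀ lam, 0 < lam → (D lam).IsNetwork lam (μ lam)) (hL : 0 < L)
    (hP : 0 < P) (hρ : 0 < ρ) (hγ : 0 < γ) (hq : 0 < q) {b : ℝ≥0∞}
    (hb : b < expNeg (M.laplaceExponent P PN ρ (γ / (P * M.maxGain)))) :
    ∀ᶠ lam in atTop, b < (D lam).coverage M (μ lam) P PN q ρ γ lam := by
  obtain ⟨t, ht, htmax, hbt⟩ :=
    M.exists_lt_expNeg_laplaceExponent hL hP hγ.le (M.maxGain_pos hL) hb
  have hvoid := tendsto_expNeg_mul_atTop ((M.measure_lt_linkGain_ne_zero_iff hL).2 htmax)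
  have hlim := ENNReal.Tendsto.sub (M.tendsto_expNeg_laplaceExponent (P := P) (PN := PN)
    (s := γ / (P * t)) hρ (tendsto_activeDensity hq hρ.le)) hvoid (.inr ENNReal.zero_ne_top)
  rw [tsub_zero] at hlim
  filter_upwards [hlim.eventually (lt_mem_nhds hbt), eventually_gt_atTop 0] with lam hlt hlam
  exact hlt.trans_le <| tsub_le_iff_right.2 <|
    (hD lam hlam).expNeg_laplaceExponent_le hL hlam hP hγ ht
      (activeDensity_div_mem_Icc hq.le hρ.le hlam)

lemma eventually_coverage_lt (hD : ∀ lam, 0 < lam → (D lam).IsNetwork lam (μ lam)) (hL : 0 < L)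
    (hP : 0 < P) (hρ : 0 < ρ) (hγ : 0 < γ) (hq : 0 < q) {b : ℝ≥0∞}
    (hb : expNeg (M.laplaceExponent P PN ρ (γ / (P * M.maxGain))) < b) :
    ∀ᶠ lam in atTop, (D lam).coverage M (μ lam) P PN q ρ γ lam < b := by
  have hdensity := tendsto_activeDensity (ρ := ρ) hq hρ.le
  have hfactor : Tendsto (fun lam => ENNReal.ofReal
      (1 - activeDensity q ρ lam / lam * (γ / (1 + γ)))) atTop (𝓝 1) := by
    simpa using ENNReal.tendsto_ofReal (tendsto_const_nhds (x := (1 : ℝ)).sub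
      ((hdensity.div_atTop tendsto_id).mul_const (γ / (1 + γ))))
  have hlim := ENNReal.Tendsto.div (M.tendsto_expNeg_laplaceExponent (P := P) (PN := PN)
    (s := γ / (P * M.maxGain)) hρ hdensity) (.inr one_ne_zero) hfactor (.inl ENNReal.one_ne_top)
  rw [div_one] at hlim
  filter_upwards [hlim.eventually (gt_mem_nhds hb), eventually_gt_atTop 0,
    hfactor.eventually (lt_mem_nhds one_pos)] with lam hlt hlam hpos
  refine lt_of_le_of_lt ?_ hlt
  rw [ENNReal.le_div_iff_mul_le (.inl hpos.ne') (.inl ENNReal.ofReal_ne_top), mul_comm]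
  exact (hD lam hlam).coverage_le hL hlam hP hγ (activeDensity_div_mem_Icc hq.le hρ.le hlam)

lemma tendsto_coverage (hD : ∀ lam, 0 < lam → (D lam).IsNetwork lam (μ lam)) (hL : 0 < L)
    (hP : 0 < P) (hρ : 0 < ρ) (hγ : 0 < γ) (hq : 0 < q) :
    Tendsto (fun lam => (D lam).coverage M (μ lam) P PN q ρ γ lam) atTop
      (𝓝 (expNeg (M.laplaceExponent P PN ρ (γ / (P * M.maxGain))))) :=
  tendsto_order.2 ⟨fun _ => eventually_lt_coverage hD hL hP hρ hγ hq,
    fun _ => eventually_coverage_lt hD hL hP hρ hγ hq⟩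

end Limit

end CellularNetwork

end

theorem theorem2 {m : ℕ} {L : ℝ} (hL : 0 < L) (M : CellularNetwork.PathLoss m L)
    (P PN ρ γ : ℝ) (hP : 0 < P) (hPN : 0 ≤ PN) (hρ : 0 < ρ) (hγ : 0 < γ) :
    ∃ c : ℝ≥0∞,
      (∀ (q : ℝ), 0 < q →
        ∀ (Ω : ℝ → Type*) [∀ lam, MeasurableSpace (Ω lam)]
          (μ : ∀ lam, Measure (Ω lam)) [∀ lam, IsProbabilityMeasure (μ lam)]
          (D : ∀ lam, CellularNetwork.Deployment (Ω lam)),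
          (∀ lam, 0 < lam → (D lam).IsNetwork lam (μ lam)) →
          Tendsto (fun lam : ℝ => (D lam).coverage M (μ lam) P PN q ρ γ lam) atTop (𝓝 c)) ∧
      ((∃ w, L < w ∧ CellularNetwork.pieceIndex M.d w = 0 ∧ 0 < M.prL 0 w) →
        (∀ w, L ≤ w → M.gainLoS w ≤ M.pieceLoS 0 L ∧ M.gainNLoS w ≤ M.pieceLoS 0 L) →
        c = M.coverageLimit P PN ρ γ) :=
  ⟨_, fun _ hq _ _ _ _ _ hD => CellularNetwork.tendsto_coverage hD hL hP hρ hγ hq,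
    fun hLoS hmax => by
      rw [M.coverageLimit_eq hL hP hPN hρ.le hγ, M.maxGain_eq_pieceLoS_zero hL hLoS hmax]⟩
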